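/- Let $G$ be the Weyl–Heisenberg group, i.e. $\mathbb R^3$ with the multiplication $(a,b,c)(\alpha,\beta,\gamma)=(a+\alpha,\,b+\beta,\,c+\gamma+a\beta)$ and its usual topology, and let $U$ be its representation $$(U(\xi)f)(x)=e^{i\xi_3}e^{ix\xi_2}f(x+\xi_1),\qquad \xi=(\xi_1,\xi_2,\xi_3)\in G,$$ on complex-valued functions on the line (unitary on $L^2(\mathbb R)$). Let $S_1(0)=\{\xi\in G:\ \xi_1\ge 0,\ \xi_2=0\}$, a closed subsemigroup of $G$ containing the identity. Let $\mathcal S$ be the Schwartz space of complex-valued functions on $\mathbb R$, let $\mathcal N=\{f\in\mathcal S:\ \int x^nf(x)\,dx=0,\ n=0,1,2,\dots\}$, and let $\mathcal N_-$ be the set of $f\in\mathcal N$ that vanish on $[0,\infty)$. Let $(\mathbb Hf)(t)=\frac1\pi\,\mathrm{p.v.}\!\int_{-\infty}^{\infty}\frac{f(x)}{x-t}\,dx$ be the Hilbert transform, which maps $\mathcal N$ into $\mathcal S$, and $P_\pm=\frac12(I\pm i\mathbb H)$. Let $$\Psi=-iP_+(\mathcal N_-)\oplus iP_-(\mathcal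 N_-)\subset\mathcal S,$$ so that each $f\in\Psi$ is $f=-iP_+g+iP_-h$ for unique $g,h\in\mathcal N_-$, with the topology given by the norms $$\|f\|_n^2=\|{-iP_+g}\|_n^2+\|iP_-h\|_n^2+\|iP_-g\|_n^2+\|{-iP_+h}\|_n^2 ,$$ where the $\|\cdot\|_n$ on the right are a sequence of norms defining the usual topology of $\mathcal S$; equivalently, $\Psi$ carries the topology induced by the map $f\mapsto(-iP_+g,\,iP_-h,\,iP_-g,\,-iP_+h)\in\mathcal S^4$. Then $\Psi$ is a complete Hausdorff topological vector space, $U(\xi)\Psi\subset\Psi$ for all $\xi\in S_1(0)$, and the restrictions $T(\xi)=U(\xi)|_\Psi$ form a differentiable representation of $S_1(0)$ in $\Psi$: each $T(\xi)$ is linear, $T(\xi\eta)=T(\xi)T(\eta)$, $T(0)=I$, the map $(\xi,\varphi)\mapsto T(\xi)\varphi$ is jointly continuous from $S_1(0)\times\Psi$ to $\Psi$, and for every continuous one-parameter subsemigroup $\{g(t)\}_{t\ge0}$ of $S_1(0)$ (with $g(0)$ the identity) the limit $\lim_{t\downarrow0}\frac{T(g(t))\varphi-\varphi}{t}$ exists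 in $\Psi$ for all $\varphi\in\Psi$ and defines a continuous linear operator on $\Psi$. This representation is non-trivial: it is not the restriction of any representation, by linear operators on $\Psi$, of the subgroup $\{(\xi_1,0,\xi_3):\ \xi_1,\xi_3\in\mathbb R\}$ of $G$, nor of any other subgroup of $G$ that contains $S_1(0)$. -/

import Mathlib

namespace RiggedWH

open Filter Topology MeasureTheory Set
open scoped SchwartzMap

noncomputable section

/-! ### The Weyl–Heisenberg group and the representation `U` -/

/-- Points `(ξ₁, ξ₂, ξ₃)` of the Weyl–Heisenberg group. -/
@[ext] structure WH where
  ξ₁ : ℝ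
  ξ₂ : ℝ
  ξ₃ : ℝ

namespace WH

instance : Mul WH := ⟨fun x y => ⟨x.ξ₁ + y.ξ₁, x.ξ₂ + y.ξ₂, x.ξ₃ + y.ξ₃ + x.ξ₁ * y.ξ₂⟩⟩
instance : One WH := ⟨⟨0, 0, 0⟩⟩
instance : Inv WH := ⟨fun x => ⟨-x.ξ₁, -x.ξ₂, -x.ξ₃ + x.ξ₁ * x.ξ₂⟩⟩

@[simp] theorem mul_ξ₁ (x y : WH) : (x * y).ξ₁ = x.ξ₁ + y.ξ₁ := rfl
@[simp] theorem mul_ξ₂ (x y : WH) : (x * y).ξ₂ = x.ξ₂ + y.ξ₂ := rfl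
@[simp] theorem mul_ξ₃ (x y : WH) : (x * y).ξ₃ = x.ξ₃ + y.ξ₃ + x.ξ₁ * y.ξ₂ := rfl
@[simp] theorem one_ξ₁ : (1 : WH).ξ₁ = 0 := rfl
@[simp] theorem one_ξ₂ : (1 : WH).ξ₂ = 0 := rfl
@[simp] theorem one_ξ₃ : (1 : WH).ξ₃ = 0 := rfl
@[simp] theorem inv_ξ₁ (x : WH) : (x⁻¹).ξ₁ = -x.ξ₁ := rfl
@[simp] theorem inv_ξ₂ (x : WH) : (x⁻¹).ξ₂ = -x.ξ₂ := rfl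
@[simp] theorem inv_ξ₃ (x : WH) : (x⁻¹).ξ₃ = -x.ξ₃ + x.ξ₁ * x.ξ₂ := rfl

instance : Group WH :=
  Group.ofLeftAxioms (fun x y z => by ext <;> simp <;> ring) (fun x => by ext <;> simp)
    (fun x => by ext <;> simp)

/-- The topology of `ℝ³`. -/
instance : TopologicalSpace WH :=
  TopologicalSpace.induced (fun x => (x.ξ₁, x.ξ₂, x.ξ₃)) (inferInstance : TopologicalSpace (ℝ × ℝ × ℝ))

end WH

/-- The subsemigroup `S₁(0) = {ξ : ξ₁ ≥ 0, ξ₂ = 0, ξ₃ ∈ ℝ}` (it contains the identity). -/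
def S10 : Submonoid WH where
  carrier := {ξ | 0 ≤ ξ.ξ₁ ∧ ξ.ξ₂ = 0}
  one_mem' := ⟨le_rfl, rfl⟩
  mul_mem' := by
    rintro x y ⟨hx, hx'⟩ ⟨hy, hy'⟩
    exact ⟨add_nonneg hx hy, by simp [hx', hy']⟩

/-- The subgroup `{(ξ₁, 0, ξ₃) : ξ₁, ξ₃ ∈ ℝ}`. -/
def K : Subgroup WH where
  carrier := {ξ | ξ.ξ₂ = 0}
  one_mem' := rfl
  mul_mem' := by
    intro x y (hx : x.ξ₂ = 0) (hy : y.ξ₂ = 0)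
    change x.ξ₂ + y.ξ₂ = 0
    rw [hx, hy, add_zero]
  inv_mem' := by
    intro x (hx : x.ξ₂ = 0)
    change -x.ξ₂ = 0
    rw [hx, neg_zero]

/-- `(U(ξ) f)(x) = e^{iξ₃} e^{ixξ₂} f(x + ξ₁)`, on complex-valued functions on the line. -/
def U : WH →* Module.End ℂ (ℝ → ℂ) where
  toFun ξ :=
    { toFun := fun f x => Complex.exp (Complex.I * ξ.ξ₃) * Complex.exp (Complex.I * x * ξ.ξ₂) *
        f (x + ξ.ξ₁)
      map_add' := fun f g => by funext x; simp only [Pi.add_apply]; ring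
      map_smul' := fun c f => by
        funext x; simp only [Pi.smul_apply, smul_eq_mul, RingHom.id_apply]; ring }
  map_one' := by
    ext f x
    simp
  map_mul' := by
    intro ξ η
    ext f x
    simp only [LinearMap.coe_mk, AddHom.coe_mk, Module.End.mul_apply, WH.mul_ξ₁, WH.mul_ξ₂,
      WH.mul_ξ₃, ← add_assoc]
    simp only [← mul_assoc, ← Complex.exp_add]
    congr 2
    push_cast
    ring

/-! ### Representations of topological semigroups -/

section Representation

variable {S : Type*} [Monoid S] [TopologicalSpace S]
variable {E : Type*} [AddCommGroup E] [Module ℂ E] [UniformSpace E]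

/-- A differentiable representation of a topological semigroup `S` (with identity) on a complete
Hausdorff topological vector space `E`. -/
structure IsDifferentiableRep (T : S → E →ₗ[ℂ] E) : Prop where
  /-- `E` is a complete Hausdorff topological vector space -/
  isUniformAddGroup : IsUniformAddGroup E
  continuousSMul : ContinuousSMul ℂ E
  t2Space : T2Space E
  completeSpace : CompleteSpace E
  /-- the action is jointly continuous -/
  continuous : Continuous fun p : S × E => T p.1 p.2
  map_mul : ∀ a b : S, ∀ φ : E, T (a * b) φ = T a (T b φ)
  map_one : ∀ φ : E, T 1 φ = φ
  /-- along every continuous one-parameter subsemigroup the derivative at `0` exists on all of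
  `E` and is a continuous linear operator -/
  differentiable : ∀ γ : NNReal → S, Continuous γ → γ 0 = 1 → (∀ s t, γ (s + t) = γ s * γ t) →
    ∃ A : E →L[ℂ] E, ∀ φ : E,
      Tendsto (fun t : NNReal => (((t : ℝ) : ℂ))⁻¹ • (T (γ t) φ - φ)) (𝓝[>] 0) (𝓝 (A φ))

end Representation

/-- The representation `T` of a subsemigroup `S` of a group `G` is the restriction of some
representation (by linear operators, without any continuity requirement) of the subgroup `H` on
the same space. -/
def ExtendsTo {G : Type*} [Group G] {E : Type*} [AddCommGroup E] [Module ℂ E] {S : Submonoid G}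
    (T : S → E →ₗ[ℂ] E) (H : Subgroup G) : Prop :=
  ∃ T' : H →* Module.End ℂ E, ∀ (ξ : G) (hS : ξ ∈ S) (hH : ξ ∈ H), T' ⟨ξ, hH⟩ = T ⟨ξ, hS⟩

/-! ### The Hilbert transform on Schwartz functions with vanishing moments -/

/-- The Hilbert transform `(ℍ f)(t) = (1/π) ∫ f(x)/(x - t) dx`, as a Cauchy principal value. -/
def pvHilbert (f : ℝ → ℂ) (t : ℝ) : ℂ :=
  limUnder (𝓝[>] (0 : ℝ)) fun ε : ℝ =>
    (1 / (Real.pi : ℂ)) * ∫ x in {x : ℝ | ε < |x - t|}, f x / ((x : ℂ) - (t : ℂ))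

/-- The symmetrised kernel of the principal value integral. -/
def symKer (f : ℝ → ℂ) (t s : ℝ) : ℂ := (f (t + s) - f (t - s)) / (s : ℂ)

theorem exists_decay (f : 𝓢(ℝ, ℂ)) : ∃ C : ℝ, 0 ≤ C ∧ ∀ x, ‖f x‖ ≤ C * (1 + x ^ 2)⁻¹ := by
  obtain ⟨A, -, hA⟩ := f.decay 0 0
  obtain ⟨B, -, hB⟩ := f.decay 2 0
  simp only [norm_iteratedFDeriv_zero, pow_zero, one_mul] at hA hB
  have hA0 : 0 ≤ A := (norm_nonneg _).trans (hA 0)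
  have hB0 : 0 ≤ B := le_trans (by positivity) (hB 0)
  refine ⟨A + B, by positivity, fun x => ?_⟩
  have h1 : (0 : ℝ) < 1 + x ^ 2 := by positivity
  rw [← div_eq_mul_inv, le_div_iff₀ h1]
  have := hA x
  have h2 := hB x
  rw [Real.norm_eq_abs, sq_abs] at h2
  nlinarith

theorem exists_lip (f : 𝓢(ℝ, ℂ)) : ∃ C : ℝ, 0 ≤ C ∧ ∀ x y, ‖f x - f y‖ ≤ C * |x - y| := by
  obtain ⟨C, hC, h⟩ := exists_decay (SchwartzMap.derivCLM ℂ ℂ f)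
  refine ⟨C, hC, fun x y => ?_⟩
  have := Convex.norm_image_sub_le_of_norm_deriv_le (f := f) (C := C) (s := univ) (x := y) (y := x)
    (fun z _ => f.differentiableAt) (fun z _ => ?_) convex_univ (mem_univ _) (mem_univ _)
  · simpa using this
  · have h1 := h z
    rw [SchwartzMap.derivCLM_apply] at h1
    refine h1.trans (mul_le_of_le_one_right hC ?_)
    exact inv_le_one_of_one_le₀ (by nlinarith [sq_nonneg z])

theorem symKer_bound (f : 𝓢(ℝ, ℂ)) (R : ℝ) : ∃ K : ℝ, ∀ t s : ℝ, |t| ≤ R → 0 < s →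
    ‖symKer f t s‖ ≤ K * (1 + s ^ 2)⁻¹ := by
  obtain ⟨C, hC, hd⟩ := exists_decay f
  obtain ⟨L, hL, hl⟩ := exists_lip f
  refine ⟨4 * L + 4 * C * (1 + R ^ 2), fun t s ht hs => ?_⟩
  have hnorm : ‖symKer f t s‖ = ‖f (t + s) - f (t - s)‖ / s := by
    simp [symKer, abs_of_pos hs]
  have ht2 : t ^ 2 ≤ R ^ 2 := by
    rw [← sq_abs t]; gcongr
  rw [hnorm, ← div_eq_mul_inv, div_le_div_iff₀ hs (by positivity)]
  rcases le_total s 1 with h1 | h1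
  · have := hl (t + s) (t - s)
    rw [show t + s - (t - s) = 2 * s by ring, abs_of_pos (by positivity)] at this
    have hs2 : s ^ 2 ≤ 1 := by nlinarith
    calc _ ≤ (L * (2 * s)) * (1 + 1) := by gcongr
      _ = 4 * L * s := by ring
      _ ≤ _ := by
        have : 0 ≤ 4 * C * (1 + R ^ 2) := by positivity
        nlinarith
  · have key : ∀ y : ℝ, |y - t| = s → ‖f y‖ * (1 + s ^ 2) ≤ 2 * C * (1 + R ^ 2) := by
      intro y hy
      have h2 := hd y
      rw [← div_eq_mul_inv, le_div_iff₀ (by positivity)] at h2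
      have h3 : 1 + s ^ 2 ≤ 2 * (1 + y ^ 2) * (1 + R ^ 2) := by
        have : s ^ 2 = (y - t) ^ 2 := by rw [← hy, sq_abs]
        rw [this]
        have : 1 + (y - t) ^ 2 ≤ 2 * (1 + y ^ 2) * (1 + t ^ 2) := by
          nlinarith [sq_nonneg (y + t), sq_nonneg (y * t)]
        refine this.trans ?_
        gcongr
      calc _ ≤ ‖f y‖ * (2 * (1 + y ^ 2) * (1 + R ^ 2)) := by gcongr
        _ = (‖f y‖ * (1 + y ^ 2)) * (2 * (1 + R ^ 2)) := by ring
        _ ≤ C * (2 * (1 + R ^ 2)) := by gcongr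
        _ = _ := by ring
    have k1 := key (t + s) (by simp [abs_of_pos hs])
    have k2 := key (t - s) (by simp [abs_of_pos hs])
    have := norm_sub_le (f (t + s)) (f (t - s))
    have h4 : 0 ≤ 4 * C * (1 + R ^ 2) := by positivity
    calc _ ≤ (‖f (t + s)‖ + ‖f (t - s)‖) * (1 + s ^ 2) := by gcongr
      _ ≤ 4 * C * (1 + R ^ 2) := by linarith
      _ ≤ 4 * C * (1 + R ^ 2) * s := by nlinarith
      _ ≤ _ := by nlinarith

theorem symKer_meas (f : 𝓢(ℝ, ℂ)) (t : ℝ) (μ : Measure ℝ) :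
    AEStronglyMeasurable (symKer f t) μ := by
  have := f.continuous
  have h : Measurable (symKer f t) := by
    unfold symKer
    fun_prop
  exact h.aestronglyMeasurable

theorem integrable_decay (K : ℝ) : IntegrableOn (fun s : ℝ => K * (1 + s ^ 2)⁻¹) (Ioi 0) :=
  (integrable_inv_one_add_sq.const_mul K).integrableOn

theorem symKer_integrable (f : 𝓢(ℝ, ℂ)) (t : ℝ) : IntegrableOn (symKer f t) (Ioi 0) := by
  obtain ⟨K, hK⟩ := symKer_bound f |t|
  refine (integrable_decay K).mono' (symKer_meas f t _) ?_
  filter_upwards [ae_restrict_mem measurableSet_Ioi] with s hs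
  exact hK t s le_rfl hs

/-- The principal value as an absolutely convergent integral. -/
def hilb (f : ℝ → ℂ) (t : ℝ) : ℂ := (1 / (Real.pi : ℂ)) * ∫ s in Ioi (0 : ℝ), symKer f t s

theorem trunc_eq (f : 𝓢(ℝ, ℂ)) (t ε : ℝ) (hε : 0 < ε) :
    ∫ x in {x : ℝ | ε < |x - t|}, f x / ((x : ℂ) - (t : ℂ)) = ∫ s in Ioi ε, symKer f t s := by
  have hset : {x : ℝ | ε < |x - t|} = Iio (t - ε) ∪ Ioi (t + ε) := by
    ext x
    simp only [mem_ofPred_eq, mem_union, mem_Iio, mem_Ioi, lt_abs]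
    constructor
    · rintro (h | h)
      · right; linarith
      · left; linarith
    · rintro (h | h)
      · right; linarith
      · left; linarith
  have hdisj : Disjoint (Iio (t - ε)) (Ioi (t + ε)) := by
    rw [Set.disjoint_left]
    intro x h1 h2
    simp only [mem_Iio, mem_Ioi] at h1 h2
    linarith
  have hint : IntegrableOn (fun x : ℝ => f x / ((x : ℂ) - (t : ℂ))) {x : ℝ | ε < |x - t|} := by
    have h1 : Integrable (fun x : ℝ => ε⁻¹ * ‖f x‖) := f.integrable.norm.const_mul _
    refine h1.integrableOn.mono' ?_ ?_
    · have := f.continuous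
      have h : Measurable (fun x : ℝ => f x / ((x : ℂ) - (t : ℂ))) := by fun_prop
      exact h.aestronglyMeasurable
    · have hm : MeasurableSet {x : ℝ | ε < |x - t|} := by
        rw [hset]; measurability
      filter_upwards [ae_restrict_mem hm] with x hx
      rw [norm_div, ← Complex.ofReal_sub, Complex.norm_real, div_eq_inv_mul, Real.norm_eq_abs]
      have : ε < |x - t| := hx
      gcongr
  rw [hset] at hint ⊢
  rw [setIntegral_union hdisj measurableSet_Ioi hint.left_of_union hint.right_of_union]
  have hR : ∫ x in Ioi (t + ε), f x / ((x : ℂ) - (t : ℂ)) = ∫ s in Ioi ε, f (t + s) / (s : ℂ) := by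
    have := (measurePreserving_add_left volume t).setIntegral_preimage_emb
      (measurableEmbedding_addLeft t) (fun x : ℝ => f x / ((x : ℂ) - (t : ℂ))) (Ioi (t + ε))
    rw [← this]
    simp
  have hL : ∫ x in Iio (t - ε), f x / ((x : ℂ) - (t : ℂ)) =
      ∫ s in Ioi ε, - (f (t - s) / (s : ℂ)) := by
    have := (Measure.measurePreserving_sub_left volume t).setIntegral_preimage_emb
      (MeasurableEquiv.subLeft t).measurableEmbedding
      (fun x : ℝ => f x / ((x : ℂ) - (t : ℂ))) (Iio (t - ε))
    rw [← this]
    simp [div_neg]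
  have hiR : IntegrableOn (fun s : ℝ => f (t + s) / (s : ℂ)) (Ioi ε) := by
    have := ((measurePreserving_add_left volume t).integrableOn_comp_preimage
      (measurableEmbedding_addLeft t) (f := fun x : ℝ => f x / ((x : ℂ) - (t : ℂ)))
      (s := Ioi (t + ε))).2 hint.right_of_union
    simpa [Function.comp_def] using this
  have hiL : IntegrableOn (fun s : ℝ => - (f (t - s) / (s : ℂ))) (Ioi ε) := by
    have := ((Measure.measurePreserving_sub_left volume t).integrableOn_comp_preimage
      (MeasurableEquiv.subLeft t).measurableEmbedding
      (f := fun x : ℝ => f x / ((x : ℂ) - (t : ℂ)))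
      (s := Iio (t - ε))).2 hint.left_of_union
    simpa [Function.comp_def, div_neg] using this
  rw [hR, hL, ← integral_add hiL hiR]
  congr 1
  funext s
  simp only [symKer]
  ring

theorem tendsto_trunc (f : 𝓢(ℝ, ℂ)) (t : ℝ) :
    Tendsto (fun ε : ℝ => (1 / (Real.pi : ℂ)) *
      ∫ x in {x : ℝ | ε < |x - t|}, f x / ((x : ℂ) - (t : ℂ))) (𝓝[>] 0) (𝓝 (hilb f t)) := by
  refine Tendsto.const_mul _ ?_
  have h0 : Tendsto (fun ε : ℝ => ε) (𝓝[>] 0) (𝓝 0) := tendsto_id.mono_left nhdsWithin_le_nhds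
  have h := (aecover_Ioi_of_Ioi (μ := (volume : Measure ℝ)) h0).integral_tendsto_of_countably_generated
    (symKer_integrable f t)
  refine h.congr' ?_
  filter_upwards [self_mem_nhdsWithin] with ε hε
  rw [trunc_eq f t ε hε, Measure.restrict_restrict measurableSet_Ioi,
    inter_eq_left.2 (Ioi_subset_Ioi (le_of_lt hε))]

theorem pvHilbert_eq (f : 𝓢(ℝ, ℂ)) : pvHilbert f = hilb f :=
  funext fun t => (tendsto_trunc f t).limUnder_eq

theorem hilb_bounded (f : 𝓢(ℝ, ℂ)) : ∃ C : ℝ, ∀ t, ‖hilb f t‖ ≤ C := by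
  obtain ⟨L, hL, hl⟩ := exists_lip f
  have hf := f.integrable (μ := (volume : Measure ℝ))
  set J : ℝ := ∫ x, ‖f x‖ with hJ
  refine ⟨1 / Real.pi * (2 * L + J + J), fun t => ?_⟩
  have hpi := Real.pi_pos
  rw [hilb, norm_mul]
  have hp : ‖(1 / (Real.pi : ℂ))‖ = 1 / Real.pi := by simp [abs_of_pos hpi]
  rw [hp]
  gcongr
  have i1 : Integrable (fun s : ℝ => ‖f (t + s)‖) := (hf.comp_add_left t).norm
  have i2 : Integrable (fun s : ℝ => ‖f (t - s)‖) := (hf.comp_sub_left t).norm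
  have i0 : Integrable ((Ioc (0:ℝ) 1).indicator fun _ => 2 * L) :=
    (integrable_indicator_iff measurableSet_Ioc).2 (integrableOn_const (by simp) enorm_ne_top)
  have ib := (i0.add i1).add i2
  have hle : ∀ s ∈ Ioi (0:ℝ), ‖symKer f t s‖ ≤
      (Ioc (0:ℝ) 1).indicator (fun _ => 2 * L) s + ‖f (t + s)‖ + ‖f (t - s)‖ := by
    intro s hs
    have hs : 0 < s := hs
    have hnorm : ‖symKer f t s‖ = ‖f (t + s) - f (t - s)‖ / s := by
      simp [symKer, abs_of_pos hs]
    rw [hnorm, div_le_iff₀ hs]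
    rcases le_or_gt s 1 with h1 | h1
    · have := hl (t + s) (t - s)
      rw [show t + s - (t - s) = 2 * s by ring, abs_of_pos (by positivity)] at this
      rw [indicator_of_mem (show s ∈ Ioc (0:ℝ) 1 from ⟨hs, h1⟩)]
      have h2 : 0 ≤ (‖f (t + s)‖ + ‖f (t - s)‖) * s := by positivity
      nlinarith
    · rw [indicator_of_notMem (fun h => absurd h.2 (not_le.2 h1))]
      have := norm_sub_le (f (t + s)) (f (t - s))
      have h2 : 0 ≤ (‖f (t + s)‖ + ‖f (t - s)‖) := by positivity
      nlinarith
  calc ‖∫ s in Ioi (0:ℝ), symKer f t s‖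
      ≤ ∫ s in Ioi (0:ℝ), ((Ioc (0:ℝ) 1).indicator (fun _ => 2 * L) s + ‖f (t + s)‖
          + ‖f (t - s)‖) := by
        refine norm_integral_le_of_norm_le ib.integrableOn ?_
        filter_upwards [ae_restrict_mem measurableSet_Ioi] with s hs using hle s hs
    _ ≤ ∫ s : ℝ, ((Ioc (0:ℝ) 1).indicator (fun _ => 2 * L) s + ‖f (t + s)‖ + ‖f (t - s)‖) := by
        refine setIntegral_le_integral ib (Eventually.of_forall fun s => ?_)
        have : 0 ≤ (Ioc (0:ℝ) 1).indicator (fun _ => 2 * L) s :=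
          indicator_nonneg (fun _ _ => by positivity) s
        simp only [Pi.zero_apply]
        positivity
    _ = 2 * L + J + J := by
        have e1 : ∫ s : ℝ, ‖f (t + s)‖ = J := integral_add_left_eq_self (fun x => ‖f x‖) t
        have e2 : ∫ s : ℝ, ‖f (t - s)‖ = J := integral_sub_left_eq_self (fun x => ‖f x‖) volume t
        have e0 : ∫ s : ℝ, (Ioc (0:ℝ) 1).indicator (fun _ => 2 * L) s = 2 * L := by
          rw [integral_indicator measurableSet_Ioc]; simp
        have a1 := integral_add (i0.add i1) i2
        have a2 := integral_add i0 i1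
        simp only [Pi.add_apply] at a1 a2
        rw [a1, a2, e0, e1, e2]

theorem hilb_hasDerivAt (f : 𝓢(ℝ, ℂ)) (t : ℝ) :
    HasDerivAt (hilb f) (hilb (SchwartzMap.derivCLM ℂ ℂ f) t) t := by
  obtain ⟨K, hK⟩ := symKer_bound (SchwartzMap.derivCLM ℂ ℂ f) (|t| + 1)
  have h := hasDerivAt_integral_of_dominated_loc_of_deriv_le (μ := volume.restrict (Ioi (0:ℝ)))
    (F := fun t s => symKer f t s) (F' := fun t s => symKer (SchwartzMap.derivCLM ℂ ℂ f) t s)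
    (x₀ := t) (s := Metric.ball t 1) (bound := fun s => K * (1 + s ^ 2)⁻¹)
    (Metric.ball_mem_nhds t one_pos)
    (Eventually.of_forall fun u => symKer_meas f u _) (symKer_integrable f t)
    (symKer_meas _ t _) ?_ (integrable_decay K) ?_
  · exact h.2.const_mul _
  · filter_upwards [ae_restrict_mem measurableSet_Ioi] with s hs u hu
    refine hK u s ?_ hs
    have : |u - t| < 1 := by simpa [Real.dist_eq] using hu
    have := abs_sub_abs_le_abs_sub u t
    linarith
  · refine Eventually.of_forall fun s u _ => ?_
    have h1 : HasDerivAt (fun u => f (u + s)) (SchwartzMap.derivCLM ℂ ℂ f (u + s)) u := by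
      rw [SchwartzMap.derivCLM_apply]
      exact (f.hasDerivAt (u + s)).comp_add_const u s
    have h2 : HasDerivAt (fun u => f (u - s)) (SchwartzMap.derivCLM ℂ ℂ f (u - s)) u := by
      rw [SchwartzMap.derivCLM_apply]
      exact (f.hasDerivAt (u - s)).comp_sub_const u s
    exact (h1.sub h2).div_const _

theorem hilb_add (f g : 𝓢(ℝ, ℂ)) (t : ℝ) : hilb (f + g : 𝓢(ℝ, ℂ)) t = hilb f t + hilb g t := by
  rw [hilb, hilb, hilb, ← mul_add, ← integral_add (symKer_integrable f t) (symKer_integrable g t)]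
  congr 2
  funext s
  simp only [symKer, add_apply]
  ring

theorem hilb_smul (c : ℂ) (f : 𝓢(ℝ, ℂ)) (t : ℝ) : hilb (c • f : 𝓢(ℝ, ℂ)) t = c * hilb f t := by
  have : ∀ s, symKer (c • f : 𝓢(ℝ, ℂ)) t s = c * symKer f t s := by
    intro s
    simp only [symKer, smul_apply, smul_eq_mul]
    ring
  simp only [hilb, this, integral_const_mul]
  ring

/-- Schwartz functions all of whose moments vanish. -/
def N : Submodule ℂ 𝓢(ℝ, ℂ) where
  carrier := {f | ∀ n : ℕ, ∫ x : ℝ, (x : ℂ) ^ n * f x = 0}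
  zero_mem' := by intro n; simp
  add_mem' := by
    intro f g hf hg n
    have h : ∀ u : 𝓢(ℝ, ℂ), Integrable (fun x : ℝ => (x : ℂ) ^ n * u x) := by
      intro u
      refine (integrable_norm_iff ?_).1 ?_
      · have := u.continuous
        fun_prop
      · simpa using u.integrable_pow_mul volume n
    simp only [add_apply, mul_add]
    rw [integral_add (h f) (h g), hf n, hg n, add_zero]
  smul_mem' := by
    intro c f hf n
    simp only [smul_apply, smul_eq_mul, mul_left_comm _ c]
    rw [integral_const_mul, hf n, mul_zero]

theorem temperate_id : Function.HasTemperateGrowth (fun x : ℝ => (x : ℂ)) := by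
  fun_prop

/-- Multiplication by `x` on Schwartz functions. -/
def mulX (f : 𝓢(ℝ, ℂ)) : 𝓢(ℝ, ℂ) := SchwartzMap.smulLeftCLM ℂ (fun x : ℝ => (x : ℂ)) f

theorem mulX_apply (f : 𝓢(ℝ, ℂ)) (x : ℝ) : mulX f x = x * f x := by
  rw [mulX, SchwartzMap.smulLeftCLM_apply_apply temperate_id, smul_eq_mul]

theorem mulX_mem {f : 𝓢(ℝ, ℂ)} (hf : f ∈ N) : mulX f ∈ N := by
  intro n
  have := hf (n + 1)
  simpa only [mulX_apply, ← mul_assoc, ← pow_succ] using this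

theorem mulX_iter_apply (f : 𝓢(ℝ, ℂ)) (n : ℕ) (x : ℝ) : (mulX^[n] f) x = (x : ℂ) ^ n * f x := by
  induction n with
  | zero => simp
  | succ n ih => rw [Function.iterate_succ_apply', mulX_apply, ih]; ring

theorem deriv_mem {f : 𝓢(ℝ, ℂ)} (hf : f ∈ N) : SchwartzMap.derivCLM ℂ ℂ f ∈ N := by
  intro n
  have h0 : ∀ n : ℕ, Integrable (fun x : ℝ => (x : ℂ) ^ n * f x) := by
    intro n
    simpa only [← mulX_iter_apply] using (mulX^[n] f).integrable
  have h1 : Integrable (fun x : ℝ => (x : ℂ) ^ n * SchwartzMap.derivCLM ℂ ℂ f x) := by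
    simpa only [← mulX_iter_apply] using (mulX^[n] (SchwartzMap.derivCLM ℂ ℂ f)).integrable
  have hd : ∀ x : ℝ, HasDerivAt (fun x : ℝ => (x : ℂ) ^ n * f x)
      ((n * (x : ℂ) ^ (n - 1)) * f x + (x : ℂ) ^ n * SchwartzMap.derivCLM ℂ ℂ f x) x := by
    intro x
    have h2 : HasDerivAt (fun x : ℝ => (x : ℂ) ^ n) (n * (x : ℂ) ^ (n - 1)) x := by
      simpa using (hasDerivAt_pow n (x : ℂ)).comp_ofReal
    rw [SchwartzMap.derivCLM_apply]
    exact h2.mul (f.hasDerivAt x)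
  have h2 : Integrable (fun x : ℝ => (n * (x : ℂ) ^ (n - 1)) * f x) := by
    simpa only [mul_assoc] using (h0 (n - 1)).const_mul (n : ℂ)
  have h3 := integral_eq_zero_of_hasDerivAt_of_integrable hd (h2.add h1) (h0 n)
  rw [integral_add h2 h1] at h3
  simp only [mul_assoc] at h3
  rw [integral_const_mul, hf (n - 1), mul_zero, zero_add] at h3
  exact h3

theorem hilb_mulX {f : 𝓢(ℝ, ℂ)} (hf : f ∈ N) (t : ℝ) : hilb (mulX f) t = t * hilb f t := by
  have hfi := f.integrable (μ := (volume : Measure ℝ))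
  have i1 : Integrable (fun s : ℝ => f (t + s)) := hfi.comp_add_left t
  have i2 : Integrable (fun s : ℝ => f (t - s)) := hfi.comp_sub_left t
  have hm : ∫ x, f x = 0 := by simpa using hf 0
  have hz : ∫ s in Ioi (0 : ℝ), (f (t + s) + f (t - s)) = 0 := by
    rw [integral_add i1.integrableOn i2.integrableOn]
    have e : ∫ s in Ioi (0 : ℝ), f (t - s) = ∫ s in Iic (0 : ℝ), f (t + s) := by
      have := integral_comp_neg_Ioi (0 : ℝ) (fun s => f (t + s))
      simpa [← sub_eq_add_neg] using this
    rw [e, add_comm, ← setIntegral_union (by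
      rw [Set.disjoint_left]; intro x h1 h2; exact not_lt.2 (mem_Iic.1 h1) (mem_Ioi.1 h2)) measurableSet_Ioi
      i1.integrableOn i1.integrableOn, Iic_union_Ioi, setIntegral_univ,
      integral_add_left_eq_self (fun x => f x) t, hm]
  have hk : ∫ s in Ioi (0 : ℝ), symKer (mulX f) t s =
      ∫ s in Ioi (0 : ℝ), (t * symKer f t s + (f (t + s) + f (t - s))) := by
    refine setIntegral_congr_fun measurableSet_Ioi fun s hs => ?_
    have : (s : ℂ) ≠ 0 := by exact_mod_cast (ne_of_gt hs)
    simp only [symKer, mulX_apply]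
    push_cast
    field_simp
    ring
  have i3 : IntegrableOn (fun s : ℝ => f (t + s) + f (t - s)) (Ioi 0) := (i1.add i2).integrableOn
  rw [hilb, hk, integral_add ((symKer_integrable f t).const_mul _) i3, hz, integral_const_mul, hilb]
  ring

theorem hilb_deriv_iter (f : 𝓢(ℝ, ℂ)) (n : ℕ) :
    iteratedDeriv n (hilb f) = hilb ((SchwartzMap.derivCLM ℂ ℂ)^[n] f) := by
  induction n with
  | zero => simp
  | succ n ih =>
    rw [iteratedDeriv_succ, ih, Function.iterate_succ_apply']
    exact funext fun t => (hilb_hasDerivAt _ t).deriv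

theorem hilb_contDiff (f : 𝓢(ℝ, ℂ)) : ContDiff ℝ ((⊤ : ℕ∞) : WithTop ℕ∞) (hilb f) := by
  refine contDiff_of_differentiable_iteratedDeriv fun n _ => ?_
  rw [hilb_deriv_iter]
  exact fun t => (hilb_hasDerivAt _ t).differentiableAt

theorem hilb_decay {f : 𝓢(ℝ, ℂ)} (hf : f ∈ N) (k n : ℕ) :
    ∃ C : ℝ, ∀ x, ‖x‖ ^ k * ‖iteratedFDeriv ℝ n (hilb f) x‖ ≤ C := by
  have hD : ∀ n, (SchwartzMap.derivCLM ℂ ℂ)^[n] f ∈ N := by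
    intro n
    induction n with
    | zero => simpa
    | succ n ih => rw [Function.iterate_succ_apply']; exact deriv_mem ih
  have hM : ∀ (g : 𝓢(ℝ, ℂ)), g ∈ N → ∀ k : ℕ, mulX^[k] g ∈ N ∧
      ∀ t : ℝ, hilb (mulX^[k] g) t = (t : ℂ) ^ k * hilb g t := by
    intro g hg k
    induction k with
    | zero => simpa
    | succ k ih =>
      rw [Function.iterate_succ_apply']
      refine ⟨mulX_mem ih.1, fun t => ?_⟩
      rw [hilb_mulX ih.1, ih.2]
      ring
  obtain ⟨C, hC⟩ := hilb_bounded (mulX^[k] ((SchwartzMap.derivCLM ℂ ℂ)^[n] f))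
  refine ⟨C, fun x => ?_⟩
  have := hC x
  rw [(hM _ (hD n) k).2 x, norm_mul, norm_pow, Complex.norm_real] at this
  rwa [norm_iteratedFDeriv_eq_norm_iteratedDeriv, hilb_deriv_iter]

/-- The Hilbert transform as a linear map from `N` to the Schwartz space. -/
def hilbertN : N →ₗ[ℂ] 𝓢(ℝ, ℂ) where
  toFun g :=
    { toFun := pvHilbert (g : 𝓢(ℝ, ℂ))
      smooth' := by rw [pvHilbert_eq]; exact hilb_contDiff _
      decay' := by
        intro k n
        rw [pvHilbert_eq]
        exact hilb_decay g.2 k n }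
  map_add' := by
    intro f g
    ext t
    change pvHilbert ((f + g : N) : 𝓢(ℝ, ℂ)) t =
      pvHilbert (f : 𝓢(ℝ, ℂ)) t + pvHilbert (g : 𝓢(ℝ, ℂ)) t
    simp only [pvHilbert_eq]
    exact hilb_add _ _ t
  map_smul' := by
    intro c f
    ext t
    change pvHilbert ((c • f : N) : 𝓢(ℝ, ℂ)) t = c * pvHilbert (f : 𝓢(ℝ, ℂ)) t
    simp only [pvHilbert_eq]
    exact hilb_smul _ _ t

/-- `P₊ = ½ (I + iℍ)`. -/
def Pplus : N →ₗ[ℂ] 𝓢(ℝ, ℂ) := (1 / 2 : ℂ) • (N.subtype + Complex.I • hilbertN)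

/-- `P₋ = ½ (I - iℍ)`. -/
def Pminus : N →ₗ[ℂ] 𝓢(ℝ, ℂ) := (1 / 2 : ℂ) • (N.subtype - Complex.I • hilbertN)

/-- The functions of `N` supported in `(-∞, 0)`. -/
def Nminus : Submodule ℂ N where
  carrier := {g | ∀ x : ℝ, 0 ≤ x → (g : 𝓢(ℝ, ℂ)) x = 0}
  zero_mem' := fun x _ => rfl
  add_mem' := by
    intro f g hf hg x hx
    simp [hf x hx, hg x hx]
  smul_mem' := by
    intro c f hf x hx
    simp [hf x hx]

/-- `(g, h) ↦ -iP₊g + iP₋h`. -/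
def J : Nminus × Nminus →ₗ[ℂ] 𝓢(ℝ, ℂ) :=
  LinearMap.coprod (-Complex.I • Pplus ∘ₗ Nminus.subtype) (Complex.I • Pminus ∘ₗ Nminus.subtype)

/-! ### Uniqueness of the decomposition `f = -iP₊g + iP₋h` -/

theorem stieltjes_deriv {κ : ℝ → ℝ} (hc : Continuous κ) (hi : Integrable κ) (n : ℕ)
    (h : ∀ t : ℝ, 0 < t → ∫ x in Iio (0 : ℝ), κ x * ((t - x)⁻¹) ^ (n + 1) = 0) :
    ∀ t : ℝ, 0 < t → ∫ x in Iio (0 : ℝ), κ x * ((t - x)⁻¹) ^ (n + 2) = 0 := by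
  intro t ht
  have hb : ∀ (m : ℕ) (u x : ℝ), t / 2 < u → x < 0 →
      ‖κ x * ((u - x)⁻¹) ^ m‖ ≤ ((t / 2)⁻¹) ^ m * ‖κ x‖ := by
    intro m u x hu hx
    have h0 : 0 < u - x := by linarith
    rw [norm_mul, mul_comm, norm_pow, norm_inv, Real.norm_of_nonneg h0.le]
    gcongr
    linarith
  have hmeas : ∀ (m : ℕ) (u : ℝ), AEStronglyMeasurable (fun x => κ x * ((u - x)⁻¹) ^ m)
      (volume.restrict (Iio 0)) := by
    intro m u
    have : Measurable (fun x => κ x * ((u - x)⁻¹) ^ m) := by fun_prop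
    exact this.aestronglyMeasurable
  have hint : ∀ (m : ℕ), IntegrableOn (fun x => κ x * ((t - x)⁻¹) ^ m) (Iio 0) := by
    intro m
    refine (hi.norm.const_mul (((t / 2)⁻¹) ^ m)).integrableOn.mono' (hmeas m t) ?_
    filter_upwards [ae_restrict_mem measurableSet_Iio] with x hx
    exact hb m t x (by linarith) hx
  have hd := hasDerivAt_integral_of_dominated_loc_of_deriv_le (μ := volume.restrict (Iio (0:ℝ)))
    (F := fun t x => κ x * ((t - x)⁻¹) ^ (n + 1))
    (F' := fun t x => -((n : ℝ) + 1) * (κ x * ((t - x)⁻¹) ^ (n + 2)))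
    (x₀ := t) (s := Ioi (t / 2))
    (bound := fun x => ((n : ℝ) + 1) * (((t / 2)⁻¹) ^ (n + 2) * ‖κ x‖))
    (Ioi_mem_nhds (by linarith)) (Eventually.of_forall fun u => hmeas _ u) (hint _)
    ((hmeas _ t).const_mul _) ?_ ((hi.norm.const_mul _).const_mul _).integrableOn ?_
  · have h1 := hd.2
    have h2 : HasDerivAt (fun t : ℝ => ∫ x in Iio (0 : ℝ), κ x * ((t - x)⁻¹) ^ (n + 1)) 0 t := by
      refine (hasDerivAt_const t (0 : ℝ)).congr_of_eventuallyEq ?_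
      filter_upwards [Ioi_mem_nhds ht] with u hu using h u hu
    have h3 := h1.unique h2
    rw [integral_const_mul] at h3
    rcases mul_eq_zero.1 h3 with h4 | h4
    · have : (0 : ℝ) ≤ n := n.cast_nonneg
      linarith
    · exact h4
  · filter_upwards [ae_restrict_mem measurableSet_Iio] with x hx u hu
    rw [norm_mul]
    have e : ‖-((n : ℝ) + 1)‖ = (n : ℝ) + 1 := by
      rw [norm_neg, Real.norm_of_nonneg (by positivity)]
    rw [e]
    gcongr
    exact hb _ u x hu hx
  · filter_upwards [ae_restrict_mem measurableSet_Iio] with x hx u hu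
    have hx : x < 0 := hx
    have hu : t / 2 < u := hu
    have h0 : u - x ≠ 0 := by linarith
    have h1 := ((((hasDerivAt_id u).sub_const x).inv h0).pow (n + 1)).const_mul (κ x)
    have h2 : HasDerivAt (fun y : ℝ => κ x * ((y - x)⁻¹) ^ (n + 1))
        (κ x * (((n + 1 : ℕ) : ℝ) * ((u - x)⁻¹) ^ n * (-1 / (u - x) ^ 2))) u := h1
    refine h2.congr_deriv ?_
    push_cast
    rw [div_eq_mul_inv, ← inv_pow]
    ring

theorem stieltjes_unique {κ : ℝ → ℝ} (hc : Continuous κ) (hi : Integrable κ)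
    (hlim : Tendsto κ atBot (𝓝 0)) (h0 : ∀ x, 0 ≤ x → κ x = 0)
    (h : ∀ t : ℝ, 0 < t → ∫ x in Iio (0 : ℝ), κ x * (t - x)⁻¹ = 0) : ∀ x, κ x = 0 := by
  have hpow : ∀ n : ℕ, ∀ t : ℝ, 0 < t → ∫ x in Iio (0 : ℝ), κ x * ((t - x)⁻¹) ^ (n + 1) = 0 := by
    intro n
    induction n with
    | zero => simpa using h
    | succ n ih => exact stieltjes_deriv hc hi n ih
  set σ : ℝ → ℝ := fun x => (1 - x)⁻¹ with hσ
  have hσm : Measurable σ := by fun_prop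
  have hσ01 : ∀ x < 0, 0 < σ x ∧ σ x ≤ 1 := by
    intro x hx
    exact ⟨inv_pos.2 (by linarith), inv_le_one_of_one_le₀ (by linarith)⟩
  -- integrals against polynomials in `σ`
  have hbd : ∀ (b : ℝ → ℝ) (B : ℝ), Measurable b → (∀ x < 0, |b x| ≤ B) →
      IntegrableOn (fun x => κ x * b x) (Iio 0) := by
    intro b B hb hB
    refine (hi.norm.const_mul B).integrableOn.mono' (hc.measurable.mul hb).aestronglyMeasurable ?_
    filter_upwards [ae_restrict_mem measurableSet_Iio] with x hx
    rw [norm_mul, mul_comm, Real.norm_eq_abs (b x)]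
    gcongr
    exact hB x hx
  have hpoly : ∀ p : Polynomial ℝ, ∫ x in Iio (0 : ℝ), κ x * (σ x * p.eval (σ x)) = 0 := by
    intro p
    have e : ∀ x, κ x * (σ x * p.eval (σ x)) =
        ∑ i ∈ Finset.range (p.natDegree + 1), p.coeff i * (κ x * (σ x) ^ (i + 1)) := by
      intro x
      rw [Polynomial.eval_eq_sum_range, Finset.mul_sum, Finset.mul_sum]
      exact Finset.sum_congr rfl fun i _ => by ring
    simp only [e]
    rw [integral_finsetSum]
    · refine Finset.sum_eq_zero fun i _ => ?_
      rw [integral_const_mul, hpow i 1 one_pos, mul_zero]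
    · intro i _
      refine (hbd (fun x => (σ x) ^ (i + 1)) 1 (hσm.pow_const _) fun x hx => ?_).const_mul _
      obtain ⟨h1, h2⟩ := hσ01 x hx
      rw [abs_of_pos (pow_pos h1 _)]
      exact pow_le_one₀ h1.le h2
  -- the function `κ` in the variable `s = σ x`
  have hq : ContinuousOn (fun s : ℝ => κ (1 - s⁻¹)) (Icc 0 1) := by
    intro s hs
    rcases eq_or_lt_of_le hs.1 with h1 | h1
    · subst h1
      have hz : κ (1 - (0 : ℝ)⁻¹) = 0 := by simpa using h0 1 zero_le_one
      rw [ContinuousWithinAt, hz]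
      have hsub : Icc (0 : ℝ) 1 ⊆ insert 0 (Ioi 0) := by
        intro u hu
        rcases eq_or_lt_of_le hu.1 with h | h
        · left; exact h.symm
        · right; exact h
      refine Tendsto.mono_left ?_ (nhdsWithin_mono _ hsub)
      rw [nhdsWithin_insert, tendsto_sup]
      constructor
      · rw [tendsto_pure_left]
        intro w hw
        rw [hz]
        exact mem_of_mem_nhds hw
      · refine hlim.comp ?_
        have : Tendsto (fun s : ℝ => s⁻¹) (𝓝[>] 0) atTop := tendsto_inv_nhdsGT_zero
        simpa [sub_eq_add_neg] using
          tendsto_atBot_add_const_left _ (1 : ℝ) (tendsto_neg_atTop_atBot.comp this)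
    · have : ContinuousAt (fun s : ℝ => κ (1 - s⁻¹)) s :=
        hc.continuousAt.comp (continuousAt_const.sub (continuousAt_inv₀ h1.ne'))
      exact this.continuousWithinAt
  have hκσ : ∀ x < 0, κ (1 - (σ x)⁻¹) = κ x := by
    intro x hx
    simp [hσ]
  obtain ⟨B, hB⟩ : ∃ B, ∀ x < 0, |κ x| ≤ B := by
    obtain ⟨B, hB⟩ := isCompact_Icc.exists_bound_of_continuousOn hq
    refine ⟨B, fun x hx => ?_⟩
    obtain ⟨h1, h2⟩ := hσ01 x hx
    have := hB (σ x) ⟨h1.le, h2⟩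
    rwa [hκσ x hx] at this
  have hI : IntegrableOn (fun x => κ x * (σ x * κ x)) (Iio 0) := by
    refine hbd (fun x => σ x * κ x) B (hσm.mul hc.measurable) fun x hx => ?_
    obtain ⟨h1, h2⟩ := hσ01 x hx
    rw [abs_mul, abs_of_pos h1]
    exact (mul_le_of_le_one_left (abs_nonneg _) h2).trans (hB x hx)
  have hzero : ∫ x in Iio (0 : ℝ), κ x * (σ x * κ x) = 0 := by
    set J : ℝ := ∫ x in Iio (0 : ℝ), ‖κ x‖
    have hJ : 0 ≤ J := integral_nonneg fun _ => norm_nonneg _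
    have hε : ∀ ε > 0, |∫ x in Iio (0 : ℝ), κ x * (σ x * κ x)| ≤ ε * J := by
      intro ε hε
      obtain ⟨p, hp⟩ := exists_polynomial_near_of_continuousOn 0 1 _ hq ε hε
      obtain ⟨P, hP⟩ := isCompact_Icc.exists_bound_of_continuousOn
        (p.continuous.continuousOn (s := Icc (0:ℝ) 1))
      have hIp : IntegrableOn (fun x => κ x * (σ x * p.eval (σ x))) (Iio 0) := by
        refine hbd (fun x => σ x * p.eval (σ x)) P
          (hσm.mul (p.continuous.measurable.comp hσm)) fun x hx => ?_
        obtain ⟨h1, h2⟩ := hσ01 x hx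
        rw [abs_mul, abs_of_pos h1]
        exact (mul_le_of_le_one_left (abs_nonneg _) h2).trans (hP _ ⟨h1.le, h2⟩)
      have hsub : ∫ x in Iio (0 : ℝ), κ x * (σ x * κ x) =
          ∫ x in Iio (0 : ℝ), (κ x * (σ x * κ x) - κ x * (σ x * p.eval (σ x))) := by
        rw [integral_sub hI hIp, hpoly p, sub_zero]
      rw [hsub, ← Real.norm_eq_abs]
      have hfin : ∫ x in Iio (0 : ℝ), ε * ‖κ x‖ = ε * J := integral_const_mul _ _
      rw [← hfin]
      refine norm_integral_le_of_norm_le (hi.norm.const_mul ε).integrableOn ?_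
      filter_upwards [ae_restrict_mem measurableSet_Iio] with x hx
      obtain ⟨h1, h2⟩ := hσ01 x hx
      have h3 := hp (σ x) ⟨h1.le, h2⟩
      rw [hκσ x hx, abs_sub_comm] at h3
      rw [← mul_sub, ← mul_sub, norm_mul, norm_mul, mul_comm, Real.norm_of_nonneg h1.le,
        Real.norm_eq_abs (κ x - _)]
      gcongr
      exact (mul_le_of_le_one_left (abs_nonneg _) h2).trans h3.le
    by_contra hne
    have hpos : 0 < |∫ x in Iio (0 : ℝ), κ x * (σ x * κ x)| := abs_pos.2 hne
    have h1 := hε (|∫ x in Iio (0 : ℝ), κ x * (σ x * κ x)| / (2 * (J + 1))) (by positivity)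
    rw [div_mul_eq_mul_div, le_div_iff₀ (by positivity)] at h1
    nlinarith
  have hnn : 0 ≤ᵐ[volume.restrict (Iio (0:ℝ))] fun x => κ x * (σ x * κ x) := by
    filter_upwards [ae_restrict_mem measurableSet_Iio] with x hx
    have := (hσ01 x hx).1
    simp only [Pi.zero_apply]
    nlinarith [mul_nonneg this.le (mul_self_nonneg (κ x))]
  have hae := (integral_eq_zero_iff_of_nonneg_ae hnn hI).1 hzero
  have hae2 : κ =ᵐ[volume] fun _ => (0 : ℝ) := by
    have := (ae_restrict_iff' measurableSet_Iio).1 hae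
    filter_upwards [this] with x hx
    rcases lt_or_ge x 0 with h1 | h1
    · have h2 := hx h1
      simp only [Pi.zero_apply, mul_eq_zero] at h2
      have := (hσ01 x h1).1.ne'
      tauto
    · exact h0 x h1
  exact fun x => congrFun ((hc.ae_eq_iff_eq volume continuous_const).1 hae2) x

theorem hilb_eq_of_neg_support (k : 𝓢(ℝ, ℂ)) (hk : ∀ x : ℝ, 0 ≤ x → k x = 0) (t : ℝ) (ht : 0 < t) :
    hilb k t = (1 / (Real.pi : ℂ)) * ∫ x in Iio (0 : ℝ), k x / ((x : ℂ) - (t : ℂ)) := by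
  refine tendsto_nhds_unique (tendsto_trunc k t) (tendsto_const_nhds.congr' ?_)
  filter_upwards [self_mem_nhdsWithin, nhdsWithin_le_nhds (Iio_mem_nhds ht)] with ε _ hε
  have hε : ε < t := hε
  congr 1
  symm
  refine setIntegral_eq_of_subset_of_forall_sdiff_eq_zero ?_ ?_ ?_
  · exact measurableSet_lt measurable_const (by fun_prop)
  · intro x hx
    have hx : x < 0 := hx
    change ε < |x - t|
    rw [abs_of_neg (by linarith)]
    linarith
  · intro x hx
    rw [hk x (not_lt.1 hx.2), zero_div]

theorem eq_zero_of_hilb_eq_zero (k : 𝓢(ℝ, ℂ)) (hk : ∀ x : ℝ, 0 ≤ x → k x = 0)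
    (h : ∀ t : ℝ, 0 < t → hilb k t = 0) : k = 0 := by
  have hki := k.integrable (μ := (volume : Measure ℝ))
  have hI : ∀ t : ℝ, 0 < t → IntegrableOn (fun x : ℝ => k x * (((t - x)⁻¹ : ℝ) : ℂ)) (Iio 0) := by
    intro t ht
    refine (hki.norm.const_mul (t⁻¹)).integrableOn.mono' ?_ ?_
    · have := k.continuous
      have hm : Measurable (fun x : ℝ => k x * (((t - x)⁻¹ : ℝ) : ℂ)) := by fun_prop
      exact hm.aestronglyMeasurable
    · filter_upwards [ae_restrict_mem measurableSet_Iio] with x hx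
      have hx : x < 0 := hx
      rw [norm_mul, mul_comm, Complex.norm_real, norm_inv, Real.norm_of_nonneg (by linarith)]
      gcongr
      linarith
  have h0 : ∀ t : ℝ, 0 < t → ∫ x in Iio (0 : ℝ), k x * (((t - x)⁻¹ : ℝ) : ℂ) = 0 := by
    intro t ht
    have h1 := h t ht
    rw [hilb_eq_of_neg_support k hk t ht] at h1
    have hpi : (1 / (Real.pi : ℂ)) ≠ 0 := by simp [Real.pi_ne_zero]
    have h2 := (mul_eq_zero.1 h1).resolve_left hpi
    have h3 : ∀ x : ℝ, k x * (((t - x)⁻¹ : ℝ) : ℂ) = -(k x / ((x : ℂ) - (t : ℂ))) := by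
      intro x
      rw [← div_neg, neg_sub, div_eq_mul_inv]
      push_cast
      rfl
    simp only [h3, integral_neg, h2, neg_zero]
  have hlim : Tendsto k atBot (𝓝 0) := k.tendsto_cocompact.mono_left atBot_le_cocompact
  have hre := stieltjes_unique (κ := fun x => (k x).re) (Complex.continuous_re.comp k.continuous)
    hki.re (by simpa [Function.comp_def] using (Complex.continuous_re.tendsto _).comp hlim)
    (fun x hx => by simp [hk x hx]) (fun t ht => by
      have := Complex.reCLM.integral_comp_comm (hI t ht)
      rw [h0 t ht] at this
      simpa only [Complex.reCLM_apply, Complex.re_mul_ofReal, Complex.zero_re] using this)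
  have him := stieltjes_unique (κ := fun x => (k x).im) (Complex.continuous_im.comp k.continuous)
    hki.im (by simpa [Function.comp_def] using (Complex.continuous_im.tendsto _).comp hlim)
    (fun x hx => by simp [hk x hx]) (fun t ht => by
      have := Complex.imCLM.integral_comp_comm (hI t ht)
      rw [h0 t ht] at this
      simpa only [Complex.imCLM_apply, Complex.im_mul_ofReal, Complex.zero_im] using this)
  ext x
  exact Complex.ext (hre x) (him x)

theorem hilbertN_apply (g : N) (t : ℝ) : hilbertN g t = hilb (g : 𝓢(ℝ, ℂ)) t :=
  congrFun (pvHilbert_eq (g : 𝓢(ℝ, ℂ))) t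

theorem J_apply (g h : Nminus) (t : ℝ) : J (g, h) t =
    (1 / 2) * (hilbertN g t + hilbertN h t) +
      (Complex.I / 2) * (((h : N) : 𝓢(ℝ, ℂ)) t - ((g : N) : 𝓢(ℝ, ℂ)) t) := by
  have hI : Complex.I * Complex.I = -1 := Complex.I_mul_I
  simp only [J, Pplus, Pminus, LinearMap.coprod_apply, LinearMap.smul_apply, LinearMap.comp_apply,
    LinearMap.add_apply, LinearMap.sub_apply, Submodule.subtype_apply, add_apply, sub_apply,
    smul_apply, smul_eq_mul]
  linear_combination (-(1 / 2) * hilbertN g t - (1 / 2) * hilbertN h t) * hI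

theorem J_injective : Function.Injective J := by
  rw [injective_iff_map_eq_zero]
  rintro ⟨g, h⟩ hJ
  have e : ∀ t : ℝ, (1 / 2) * (hilbertN g t + hilbertN h t) +
      (Complex.I / 2) * (((h : N) : 𝓢(ℝ, ℂ)) t - ((g : N) : 𝓢(ℝ, ℂ)) t) = 0 := by
    intro t
    rw [← J_apply, hJ]
    rfl
  have hk : ((g + h : Nminus) : N) = 0 := by
    refine Subtype.ext (eq_zero_of_hilb_eq_zero _ (g + h).2 fun t ht => ?_)
    rw [← hilbertN_apply, Submodule.coe_add, map_add, add_apply]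
    have := e t
    rw [g.2 t ht.le, h.2 t ht.le] at this
    linear_combination 2 * this
  have hh : (h : N) = -g := by
    rw [Submodule.coe_add] at hk
    exact (neg_eq_of_add_eq_zero_right hk).symm
  have hg : g = 0 := by
    refine Subtype.ext (Subtype.ext (SchwartzMap.ext fun t => ?_))
    have := e t
    rw [hh, map_neg, neg_apply, Submodule.coe_neg, neg_apply] at this
    change ((g : N) : 𝓢(ℝ, ℂ)) t = 0
    linear_combination Complex.I * this + ((g : N) : 𝓢(ℝ, ℂ)) t * Complex.I_mul_I
  subst hg
  have : h = 0 := Subtype.ext (by rw [hh]; simp)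
  rw [this]
  rfl

/-! ### The space `Ψ` -/

/-- The vector space `-iP₊(N₋) ⊕ iP₋(N₋)` of Schwartz functions. -/
def PsiSubmodule : Submodule ℂ 𝓢(ℝ, ℂ) := LinearMap.range J

/-- `Ψ`: the space `-iP₊(N₋) ⊕ iP₋(N₋)`; its topology, given below, is finer than the one it
inherits from the Schwartz space. -/
def Psi : Type := PsiSubmodule

namespace Psi

instance : AddCommGroup Psi := inferInstanceAs (AddCommGroup PsiSubmodule)
instance : Module ℂ Psi := inferInstanceAs (Module ℂ PsiSubmodule)

/-- An element of `Ψ` as a Schwartz function. -/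
def toSchwartz : Psi →ₗ[ℂ] 𝓢(ℝ, ℂ) := PsiSubmodule.subtype

/-- The unique pair `(g, h)` in `N₋ × N₋` with `f = -iP₊g + iP₋h`. -/
def decomp : Psi ≃ₗ[ℂ] Nminus × Nminus := (LinearEquiv.ofInjective J J_injective).symm

/-- For `f = -iP₊g + iP₋h`, the four Schwartz functions `-iP₊g`, `iP₋h`, `iP₋g`, `-iP₊h`. -/
def components (f : Psi) : 𝓢(ℝ, ℂ) × 𝓢(ℝ, ℂ) × 𝓢(ℝ, ℂ) × 𝓢(ℝ, ℂ) :=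
  (-Complex.I • Pplus (decomp f).1, Complex.I • Pminus (decomp f).2,
    Complex.I • Pminus (decomp f).1, -Complex.I • Pplus (decomp f).2)

/-- The structure given by the norms
`‖f‖ₙ² = ‖-iP₊g‖ₙ² + ‖iP₋h‖ₙ² + ‖iP₋g‖ₙ² + ‖-iP₊h‖ₙ²`, where on the right `‖·‖ₙ` runs through
the norms defining the topology of the Schwartz space. -/
instance : UniformSpace Psi := UniformSpace.comap components inferInstance

end Psi

end

end RiggedWH

/-! On `S₁(0)` the operator `U(ξ)` is the scalar `e^{iξ₃}` times the translation `f ↦ f(· + a)`, `a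
= ξ₁ ≥ 0`. Translation commutes with `ℍ`, keeps all moments zero, and for `a ≥ 0` keeps functions
that vanish on `[0, ∞)` of that kind. So it acts on pairs `(g, h)` from `N₋` and hence on `Ψ`. On
the four components it is translation in each slot, and continuity and differentiability of `T`
reduce to those of translation on Schwartz space (`continuous_translate`,
`tendsto_translate_slope`). Every one-parameter subsemigroup has the form `(αt, 0, βt)`; its
generator is `iβ + αD`, and `D` acts on `Ψ` for the same reasons as translation (`Admissible`).

Completeness of `Ψ` is completeness of its image in `𝓢⁴`. The components determine `g`, `ℍg`, `h`,
`ℍh` linearly, so the image consists of the quadruples for which two derived pairs lie in the graph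
of `ℍ` on `N₋` (`range_components`). That graph is closed because moments, point values and point
values of `ℍ` are continuous functionals on `𝓢` (`isClosed_graph`).

A representation of a group acts by bijections, so it suffices that some `T(ξ)` is not surjective.
Translation by `a > 0` turns an element of `N₋` into one that vanishes at `-a`. The function `flat`,
a multiple of `e^{-log²|x|} sin(2π log|x|)` on the negative axis, lies in `N₋` and is nonzero at
`-e^{1/4}`; it is a Stieltjes-type example of vanishing moments. -/

namespace RiggedWH

open Filter Topology MeasureTheory Set
open scoped SchwartzMap

noncomputable section

/-! ### The Schwartz space on the line -/

/-- Differentiation on the Schwartz space. -/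
def D : 𝓢(ℝ, ℂ) →L[ℂ] 𝓢(ℝ, ℂ) := SchwartzMap.derivCLM ℂ ℂ

theorem hasDerivAt_D (f : 𝓢(ℝ, ℂ)) (x : ℝ) : HasDerivAt f (D f x) x := f.hasDerivAt x

theorem D_pow_succ_apply (n : ℕ) (f : 𝓢(ℝ, ℂ)) : (D ^ (n + 1)) f = D ((D ^ n) f) := by
  rw [pow_succ', mul_apply_eq_comp]

theorem D_pow_D_apply (n : ℕ) (f : 𝓢(ℝ, ℂ)) : (D ^ n) (D f) = (D ^ (n + 1)) f := by
  rw [pow_succ, mul_apply_eq_comp]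

theorem iteratedDeriv_eq_D_pow (n : ℕ) (f : 𝓢(ℝ, ℂ)) : iteratedDeriv n f = (D ^ n) f := by
  induction n with
  | zero => ext; simp
  | succ n ih =>
    rw [iteratedDeriv_succ, ih, D_pow_succ_apply]
    rfl

theorem le_seminorm_D (k n : ℕ) (f : 𝓢(ℝ, ℂ)) (x : ℝ) :
    |x| ^ k * ‖(D ^ n) f x‖ ≤ SchwartzMap.seminorm ℂ k n f := by
  rw [← iteratedDeriv_eq_D_pow]
  exact SchwartzMap.le_seminorm' ℂ k n f x

theorem seminorm_le_of_D (k n : ℕ) (f : 𝓢(ℝ, ℂ)) {M : ℝ}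
    (h : ∀ x, |x| ^ k * ‖(D ^ n) f x‖ ≤ M) : SchwartzMap.seminorm ℂ k n f ≤ M := by
  refine SchwartzMap.seminorm_le_bound' ℂ k n f (le_trans (by positivity) (h 0)) fun x => ?_
  rw [iteratedDeriv_eq_D_pow]
  exact h x

theorem seminorm_D (k n : ℕ) (f : 𝓢(ℝ, ℂ)) :
    SchwartzMap.seminorm ℂ k n (D f) = SchwartzMap.seminorm ℂ k (n + 1) f := by
  apply le_antisymm
  · refine seminorm_le_of_D k n _ fun x => ?_
    rw [D_pow_D_apply]
    exact le_seminorm_D k (n + 1) f x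
  · refine seminorm_le_of_D k (n + 1) _ fun x => ?_
    rw [← D_pow_D_apply]
    exact le_seminorm_D k n (D f) x

theorem schwartz_tendsto_iff {ι : Type*} {l : Filter ι} (u : ι → 𝓢(ℝ, ℂ)) (f : 𝓢(ℝ, ℂ)) :
    Tendsto u l (𝓝 f) ↔
      ∀ k n : ℕ, Tendsto (fun i => SchwartzMap.seminorm ℂ k n (u i - f)) l (𝓝 0) := by
  rw [(schwartz_withSeminorms ℂ ℝ ℂ).tendsto_nhds]
  constructor
  · intro h k n
    rw [Metric.tendsto_nhds]
    intro ε hε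
    filter_upwards [h (k, n) ε hε] with i hi
    rw [Real.dist_eq, sub_zero, abs_of_nonneg (apply_nonneg _ _)]
    exact hi
  · rintro h ⟨k, n⟩ ε hε
    exact (h k n).eventually_lt_const hε

theorem seminorm_continuous (k n : ℕ) : Continuous (SchwartzMap.seminorm ℂ k n : 𝓢(ℝ, ℂ) → ℝ) :=
  (schwartz_withSeminorms ℂ ℝ ℂ).continuous_seminorm (k, n)

/-! ### Completeness of the Schwartz space -/

theorem seminorm_cauchy {u : ℕ → 𝓢(ℝ, ℂ)} (hu : CauchySeq u) (k n : ℕ) {ε : ℝ} (hε : 0 < ε) :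
    ∃ M, ∀ m ≥ M, ∀ m' ≥ M, SchwartzMap.seminorm ℂ k n (u m' - u m) < ε := by
  have h1 : Tendsto (fun p : ℕ × ℕ => u p.2 - u p.1) atTop (𝓝 0) := by
    have := cauchySeq_iff_tendsto.1 hu
    rw [uniformity_eq_comap_nhds_zero, tendsto_comap_iff] at this
    exact this
  have h2 := (schwartz_tendsto_iff _ _).1 h1 k n
  obtain ⟨⟨a, b⟩, hab⟩ := eventually_atTop.1 (h2.eventually_lt_const hε)
  refine ⟨max a b, fun m hm m' hm' => ?_⟩
  simpa using hab (m, m') ⟨(le_max_left _ _).trans hm, (le_max_right _ _).trans hm'⟩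

/-- The topology is countably generated, so Cauchy sequences suffice. All derivatives converge
uniformly, so the limits `F n` are the successive derivatives of `F 0`; the weighted Cauchy
estimates pass to the pointwise limit. -/
instance schwartz_completeSpace : CompleteSpace 𝓢(ℝ, ℂ) := by
  have : (uniformity 𝓢(ℝ, ℂ)).IsCountablyGenerated :=
    IsUniformAddGroup.uniformity_countably_generated
  refine UniformSpace.complete_of_cauchySeq_tendsto fun u hu => ?_
  have hle : ∀ n m m' x, ‖(D ^ n) (u m') x - (D ^ n) (u m) x‖ ≤
      SchwartzMap.seminorm ℂ 0 n (u m' - u m) := by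
    intro n m m' x
    have := le_seminorm_D 0 n (u m' - u m) x
    rwa [pow_zero, one_mul, map_sub] at this
  have hpt : ∀ n x, ∃ y, Tendsto (fun m => (D ^ n) (u m) x) atTop (𝓝 y) := by
    intro n x
    refine cauchySeq_tendsto_of_complete (Metric.cauchySeq_iff.2 fun ε hε => ?_)
    obtain ⟨M, hM⟩ := seminorm_cauchy hu 0 n hε
    refine ⟨M, fun m hm m' hm' => ?_⟩
    rw [dist_eq_norm]
    exact (hle n m' m x).trans_lt (hM m' hm' m hm)
  choose F hF using hpt
  have hunif : ∀ n, TendstoUniformly (fun m x => (D ^ n) (u m) x) (F n) atTop := by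
    intro n
    rw [← tendstoUniformlyOn_univ]
    refine UniformCauchySeqOn.tendstoUniformlyOn_of_tendsto ?_ fun x _ => hF n x
    rw [Metric.uniformCauchySeqOn_iff]
    intro ε hε
    obtain ⟨M, hM⟩ := seminorm_cauchy hu 0 n hε
    refine ⟨M, fun m hm m' hm' x _ => ?_⟩
    rw [dist_eq_norm]
    exact (hle n m' m x).trans_lt (hM m' hm' m hm)
  have hderiv : ∀ n x, HasDerivAt (F n) (F (n + 1) x) x := by
    intro n x
    refine hasDerivAt_of_tendstoUniformly (hunif (n + 1)) (Eventually.of_forall fun m y => ?_)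
      (hF n) x
    rw [D_pow_succ_apply]
    exact hasDerivAt_D _ y
  have hiter : ∀ n, iteratedDeriv n (F 0) = F n := by
    intro n
    induction n with
    | zero => simp
    | succ n ih =>
      rw [iteratedDeriv_succ, ih]
      exact funext fun x => (hderiv n x).deriv
  -- Used twice: `f = 0` gives the decay of the limit, and `f = u m` gives convergence in each
  -- seminorm.
  have hbound : ∀ k n, ∀ f : 𝓢(ℝ, ℂ), ∀ C : ℝ, (∀ᶠ m in atTop,
      SchwartzMap.seminorm ℂ k n (u m - f) ≤ C) → ∀ x, |x| ^ k * ‖F n x - (D ^ n) f x‖ ≤ C := by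
    intro k n f C hC x
    have h1 : Tendsto (fun m => |x| ^ k * ‖(D ^ n) (u m) x - (D ^ n) f x‖) atTop
        (𝓝 (|x| ^ k * ‖F n x - (D ^ n) f x‖)) := ((hF n x).sub_const _).norm.const_mul _
    refine le_of_tendsto h1 ?_
    filter_upwards [hC] with m hm
    have := le_seminorm_D k n (u m - f) x
    rw [map_sub] at this
    exact this.trans hm
  have hdecay : ∀ k n, ∃ C : ℝ, ∀ x, |x| ^ k * ‖F n x‖ ≤ C := by
    intro k n
    obtain ⟨M, hM⟩ := seminorm_cauchy hu k n one_pos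
    refine ⟨SchwartzMap.seminorm ℂ k n (u M) + 1, fun x => ?_⟩
    have := hbound k n 0 (SchwartzMap.seminorm ℂ k n (u M) + 1) (by
      filter_upwards [eventually_ge_atTop M] with m hm
      have h1 := map_add_le_add (SchwartzMap.seminorm ℂ k n) (u m - u M) (u M)
      rw [sub_add_cancel] at h1
      rw [sub_zero]
      have := hM M le_rfl m hm
      linarith) x
    simpa using this
  let f : 𝓢(ℝ, ℂ) :=
    { toFun := F 0
      smooth' := contDiff_of_differentiable_iteratedDeriv fun n _ => by
        rw [hiter]
        exact fun x => (hderiv n x).differentiableAt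
      decay' := by
        intro k n
        obtain ⟨C, hC⟩ := hdecay k n
        refine ⟨C, fun x => ?_⟩
        rw [norm_iteratedFDeriv_eq_norm_iteratedDeriv, hiter]
        exact hC x }
  have hf : ∀ n x, (D ^ n) f x = F n x := by
    intro n x
    rw [← iteratedDeriv_eq_D_pow, ← hiter n]
    rfl
  refine ⟨f, (schwartz_tendsto_iff _ _).2 fun k n => ?_⟩
  rw [Metric.tendsto_atTop]
  intro ε hε
  obtain ⟨M, hM⟩ := seminorm_cauchy hu k n (half_pos hε)
  refine ⟨M, fun m hm => ?_⟩
  rw [Real.dist_eq, sub_zero, abs_of_nonneg (apply_nonneg _ _)]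
  refine (seminorm_le_of_D k n _ fun x => ?_).trans_lt (half_lt_self hε)
  rw [map_sub, sub_apply, hf, norm_sub_rev]
  refine hbound k n (u m) (ε / 2) ?_ x
  filter_upwards [eventually_ge_atTop M] with m' hm'
  exact (hM m hm m' hm').le

/-! ### Translations -/

/-- The translation `f ↦ f(· + a)`. -/
def translate (a : ℝ) : 𝓢(ℝ, ℂ) →L[ℂ] 𝓢(ℝ, ℂ) := SchwartzMap.compSubConstCLM ℂ (-a)

@[simp] theorem translate_apply (a : ℝ) (f : 𝓢(ℝ, ℂ)) (x : ℝ) : translate a f x = f (x + a) := by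
  simp [translate]

@[simp] theorem translate_zero (f : 𝓢(ℝ, ℂ)) : translate 0 f = f := by
  ext x
  simp

theorem translate_add (a b : ℝ) (f : 𝓢(ℝ, ℂ)) :
    translate (a + b) f = translate a (translate b f) := by
  ext x
  simp [add_assoc]

theorem D_translate (a : ℝ) (f : 𝓢(ℝ, ℂ)) : D (translate a f) = translate a (D f) := by
  ext x
  refine (hasDerivAt_D _ x).unique ?_
  rw [translate_apply]
  have h : ⇑(translate a f) = fun x => f (x + a) := funext fun x => translate_apply a f x
  rw [h]
  exact (hasDerivAt_D f (x + a)).comp_add_const x a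

theorem D_pow_translate (n : ℕ) (a : ℝ) (f : 𝓢(ℝ, ℂ)) :
    (D ^ n) (translate a f) = translate a ((D ^ n) f) := by
  induction n with
  | zero => rfl
  | succ n ih => rw [D_pow_succ_apply, D_pow_succ_apply, ih, D_translate]

/-- A seminorm dominating the `(k, n)` seminorms of the translates by at most `R`. -/
def transBound (R : ℝ) (k n : ℕ) (f : 𝓢(ℝ, ℂ)) : ℝ :=
  2 ^ k * (SchwartzMap.seminorm ℂ k n f + R ^ k * SchwartzMap.seminorm ℂ 0 n f)

theorem transBound_continuous (R : ℝ) (k n : ℕ) : Continuous (transBound R k n) :=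
  continuous_const.mul ((seminorm_continuous k n).add
    (continuous_const.mul (seminorm_continuous 0 n)))

theorem transBound_nonneg {R : ℝ} (hR : 0 ≤ R) (k n : ℕ) (f : 𝓢(ℝ, ℂ)) :
    0 ≤ transBound R k n f := by
  unfold transBound
  have h1 : 0 ≤ SchwartzMap.seminorm ℂ k n f := apply_nonneg _ _
  have h2 : 0 ≤ SchwartzMap.seminorm ℂ 0 n f := apply_nonneg _ _
  positivity

theorem seminorm_translate_le {R a : ℝ} (ha : |a| ≤ R) (k n : ℕ) (f : 𝓢(ℝ, ℂ)) :
    SchwartzMap.seminorm ℂ k n (translate a f) ≤ transBound R k n f := by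
  refine seminorm_le_of_D k n _ fun x => ?_
  rw [D_pow_translate, translate_apply]
  have hR : 0 ≤ R := (abs_nonneg a).trans ha
  have h1 := le_seminorm_D k n f (x + a)
  have h2 := le_seminorm_D 0 n f (x + a)
  rw [pow_zero, one_mul] at h2
  -- The sharper constant `2 ^ (k - 1)` is relaxed to `2 ^ k`, which avoids the truncated exponent
  -- in `transBound`.
  have h3 : |x| ^ k ≤ 2 ^ k * (|x + a| ^ k + R ^ k) := by
    have : |x| ≤ |x + a| + R := by
      have := abs_sub (x + a) a
      rw [add_sub_cancel_right] at this
      linarith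
    calc |x| ^ k ≤ (|x + a| + R) ^ k := by gcongr
      _ ≤ 2 ^ (k - 1) * (|x + a| ^ k + R ^ k) := add_pow_le (abs_nonneg _) hR k
      _ ≤ _ := by
        gcongr
        · norm_num
        · omega
  calc |x| ^ k * ‖(D ^ n) f (x + a)‖
      ≤ (2 ^ k * (|x + a| ^ k + R ^ k)) * ‖(D ^ n) f (x + a)‖ := by gcongr
    _ = 2 ^ k * (|x + a| ^ k * ‖(D ^ n) f (x + a)‖ + R ^ k * ‖(D ^ n) f (x + a)‖) := by ring
    _ ≤ _ := by unfold transBound; gcongr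

/-- Mean value inequality in `s`, for fixed `x`, applied to `|x|^k (f⁽ⁿ⁾(x + s) - s g⁽ⁿ⁾(x))`.
Taking `g = 0` gives the first-order estimate, `g = D f` the Taylor remainder. -/
theorem seminorm_translate_sub_le (f g : 𝓢(ℝ, ℂ)) (k n : ℕ) (a : ℝ) {M : ℝ}
    (h : ∀ s, |s| ≤ |a| → SchwartzMap.seminorm ℂ k n (translate s (D f) - g) ≤ M) :
    SchwartzMap.seminorm ℂ k n (translate a f - f - (a : ℂ) • g) ≤ M * |a| := by
  refine seminorm_le_of_D k n _ fun x => ?_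
  have hd : ∀ s : ℝ, HasDerivAt
      (fun s : ℝ => ((|x| ^ k : ℝ) : ℂ) * ((D ^ n) f (x + s) - (s : ℂ) * (D ^ n) g x))
      (((|x| ^ k : ℝ) : ℂ) * ((D ^ n) (translate s (D f) - g) x)) s := by
    intro s
    rw [map_sub, sub_apply, D_pow_translate, translate_apply, D_pow_D_apply, D_pow_succ_apply]
    have h1 := (hasDerivAt_D ((D ^ n) f) (x + s)).comp_const_add x s
    have h2 : HasDerivAt (fun s : ℝ => (s : ℂ) * (D ^ n) g x) (1 * (D ^ n) g x) s :=
      (Complex.ofRealCLM.hasDerivAt (x := s)).mul_const _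
    rw [one_mul] at h2
    exact (h1.sub h2).const_mul _
  have hmv := (convex_Icc (-|a|) |a|).norm_image_sub_le_of_norm_hasDerivWithin_le (C := M)
    (fun s _ => (hd s).hasDerivWithinAt) (fun s hs => ?_)
    (x := 0) (y := a) ⟨by simp, by simp⟩ ⟨neg_abs_le a, le_abs_self a⟩
  · have e : ((|x| ^ k : ℝ) : ℂ) * ((D ^ n) f (x + a) - (a : ℂ) * (D ^ n) g x) -
        ((|x| ^ k : ℝ) : ℂ) * ((D ^ n) f (x + 0) - ((0 : ℝ) : ℂ) * (D ^ n) g x) =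
        ((|x| ^ k : ℝ) : ℂ) * (D ^ n) (translate a f - f - (a : ℂ) • g) x := by
      simp only [map_sub, map_smul, sub_apply, smul_apply, D_pow_translate, translate_apply,
        smul_eq_mul, add_zero, Complex.ofReal_zero]
      ring
    rw [e, norm_mul, Complex.norm_real, Real.norm_of_nonneg (by positivity), sub_zero,
      Real.norm_eq_abs] at hmv
    exact hmv
  · rw [norm_mul, Complex.norm_real, Real.norm_of_nonneg (by positivity)]
    exact (le_seminorm_D k n _ x).trans (h s (abs_le.2 hs))

theorem seminorm_translate_sub_self_le (f : 𝓢(ℝ, ℂ)) (k n : ℕ) (a : ℝ) :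
    SchwartzMap.seminorm ℂ k n (translate a f - f) ≤ transBound |a| k n (D f) * |a| := by
  have := seminorm_translate_sub_le f 0 k n a (M := transBound |a| k n (D f)) fun s hs => by
    rw [sub_zero]
    exact seminorm_translate_le hs k n (D f)
  simpa using this

/-- The mean value estimate is used twice: the case `g = 0`, for `D f`, supplies the bound `M`
needed in the case `g = D f`. Hence the remainder is quadratic in `a`. -/
theorem seminorm_translate_taylor_le (f : 𝓢(ℝ, ℂ)) (k n : ℕ) (a : ℝ) :
    SchwartzMap.seminorm ℂ k n (translate a f - f - (a : ℂ) • D f) ≤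
      transBound |a| k n (D (D f)) * |a| * |a| := by
  refine seminorm_translate_sub_le f (D f) k n a fun s hs => ?_
  refine (seminorm_translate_sub_le (D f) 0 k n s (M := transBound |a| k n (D (D f)))
    fun r hr => ?_).trans ?_ |> fun h => by simpa using h
  · rw [sub_zero]
    exact seminorm_translate_le (hr.trans hs) k n _
  · have := transBound_nonneg (abs_nonneg a) k n (D (D f))
    gcongr

theorem continuous_transBound_left (k n : ℕ) (f : 𝓢(ℝ, ℂ)) :
    Continuous fun R => transBound R k n f := by
  unfold transBound
  fun_prop

theorem tendsto_translate_zero (f : 𝓢(ℝ, ℂ)) :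
    Tendsto (fun a => translate a f) (𝓝 0) (𝓝 f) := by
  refine (schwartz_tendsto_iff _ _).2 fun k n => ?_
  have h : Continuous fun a : ℝ => transBound |a| k n (D f) * |a| :=
    ((continuous_transBound_left k n _).comp continuous_abs).mul continuous_abs
  have h0 := h.tendsto 0
  rw [abs_zero, mul_zero] at h0
  exact squeeze_zero (fun _ => apply_nonneg _ _)
    (fun a => seminorm_translate_sub_self_le f k n a) h0

/-- Near `(a, f)` the translate of `p.2` by `p.1` splits into the translate of `p.2 - f`, small
because `transBound` is uniform for bounded shifts, and a translate of the fixed `f`, handled by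
continuity at shift zero. -/
theorem continuous_translate : Continuous fun p : ℝ × 𝓢(ℝ, ℂ) => translate p.1 p.2 := by
  rw [continuous_iff_continuousAt]
  rintro ⟨a, f⟩
  have h1 : Tendsto (fun p : ℝ × 𝓢(ℝ, ℂ) => translate p.1 (p.2 - f)) (𝓝 (a, f)) (𝓝 0) := by
    refine (schwartz_tendsto_iff _ _).2 fun k n => ?_
    have h : Continuous fun p : ℝ × 𝓢(ℝ, ℂ) => transBound (|a| + 1) k n (p.2 - f) :=
      (transBound_continuous _ k n).comp (continuous_snd.sub continuous_const)
    have h0 := h.tendsto (a, f)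
    simp only [sub_self] at h0
    have hz : transBound (|a| + 1) k n 0 = 0 := by simp [transBound]
    rw [hz] at h0
    refine squeeze_zero' (Eventually.of_forall fun _ => apply_nonneg _ _) ?_ h0
    have : ∀ᶠ p : ℝ × 𝓢(ℝ, ℂ) in 𝓝 (a, f), |p.1| < |a| + 1 :=
      (continuous_abs.comp continuous_fst).continuousAt.eventually_lt_const (by simp)
    filter_upwards [this] with p hp
    rw [sub_zero]
    exact seminorm_translate_le hp.le k n _
  have h2 : Tendsto (fun p : ℝ × 𝓢(ℝ, ℂ) => translate a (translate (p.1 - a) f)) (𝓝 (a, f))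
      (𝓝 (translate a f)) := by
    refine ((translate a).continuous.tendsto _).comp ((tendsto_translate_zero f).comp ?_)
    have : Continuous fun p : ℝ × 𝓢(ℝ, ℂ) => p.1 - a := by fun_prop
    simpa using this.tendsto (a, f)
  have h3 := h1.add h2
  rw [zero_add] at h3
  refine h3.congr fun p => ?_
  rw [← translate_add, add_sub_cancel, map_sub, sub_add_cancel]

theorem tendsto_translate_slope (f : 𝓢(ℝ, ℂ)) (α : ℝ) :
    Tendsto (fun t : ℝ => (t : ℂ)⁻¹ • (translate (α * t) f - f)) (𝓝[>] 0)
      (𝓝 ((α : ℂ) • D f)) := by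
  refine (schwartz_tendsto_iff _ _).2 fun k n => ?_
  -- This is the quadratic Taylor remainder divided by `t`; the surviving factor `|α * t|` drives it
  -- to zero.
  have h : Continuous fun t : ℝ => transBound |α * t| k n (D (D f)) * |α| * |α * t| :=
    (((continuous_transBound_left k n _).comp (by fun_prop : Continuous fun t : ℝ => |α * t|)).mul
      continuous_const).mul (by fun_prop)
  have h0 := (h.tendsto 0).mono_left (nhdsWithin_le_nhds (s := Ioi 0))
  simp only [mul_zero, abs_zero] at h0
  refine squeeze_zero' (Eventually.of_forall fun _ => apply_nonneg _ _) ?_ h0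
  filter_upwards [self_mem_nhdsWithin] with t ht
  have ht : 0 < t := ht
  have htc : (t : ℂ) ≠ 0 := by exact_mod_cast ht.ne'
  have e : (t : ℂ)⁻¹ • (translate (α * t) f - f) - (α : ℂ) • D f =
      (t : ℂ)⁻¹ • (translate (α * t) f - f - ((α * t : ℝ) : ℂ) • D f) := by
    rw [smul_sub _ _ (_ • D f), smul_smul]
    congr 2
    push_cast
    field_simp
  rw [e, map_smul_eq_mul, norm_inv, Complex.norm_real, Real.norm_of_nonneg ht.le,
    inv_mul_le_iff₀ ht]
  refine (seminorm_translate_taylor_le f k n (α * t)).trans (le_of_eq ?_)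
  rw [abs_mul, abs_of_pos ht]
  ring

/-! ### Continuity and covariance of the Hilbert transform -/

theorem hilb_translate (a t : ℝ) (f : 𝓢(ℝ, ℂ)) : hilb (translate a f) t = hilb f (t + a) := by
  have : ∀ s, symKer (translate a f) t s = symKer f (t + a) s := by
    intro s
    simp only [symKer, translate_apply]
    rw [show t + s + a = t + a + s by ring, show t - s + a = t + a - s by ring]
  simp only [hilb, this]

theorem hilb_D (t : ℝ) (f : 𝓢(ℝ, ℂ)) : HasDerivAt (hilb f) (hilb (D f) t) t := hilb_hasDerivAt f t

/-- For `s ≤ 1` the mean value inequality controls the difference quotient, and for `s ≥ 1` the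
decay of `f` does. The 4 is a factor 2 from the distance between `s` and `-s` and a factor 2 from `1
+ s² ≤ 2`. -/
theorem norm_hilb_zero_le (f : 𝓢(ℝ, ℂ)) :
    ‖hilb f 0‖ ≤ 1 / Real.pi * ((4 * (SchwartzMap.seminorm ℂ 0 1 f + SchwartzMap.seminorm ℂ 0 0 f +
      SchwartzMap.seminorm ℂ 2 0 f)) * ∫ s in Ioi (0 : ℝ), (1 + s ^ 2)⁻¹) := by
  set p := SchwartzMap.seminorm ℂ 0 1 f with hp
  set q := SchwartzMap.seminorm ℂ 0 0 f with hq
  set r := SchwartzMap.seminorm ℂ 2 0 f with hr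
  have hp0 : 0 ≤ p := apply_nonneg _ _
  have hq0 : 0 ≤ q := apply_nonneg _ _
  have hr0 : 0 ≤ r := apply_nonneg _ _
  have hb : ∀ s : ℝ, 0 < s → ‖symKer f 0 s‖ ≤ (4 * (p + q + r)) * (1 + s ^ 2)⁻¹ := by
    intro s hs
    have hnorm : ‖symKer f 0 s‖ = ‖f s - f (-s)‖ / s := by
      simp [symKer, abs_of_pos hs]
    rw [hnorm, ← div_eq_mul_inv, div_le_div_iff₀ hs (by positivity)]
    rcases le_total s 1 with h1 | h1
    · have hl : ‖f s - f (-s)‖ ≤ p * ‖s - -s‖ :=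
        Convex.norm_image_sub_le_of_norm_hasDerivWithin_le (s := univ)
          (fun z _ => (hasDerivAt_D f z).hasDerivWithinAt)
          (fun z _ => by simpa using le_seminorm_D 0 1 f z) convex_univ (mem_univ _) (mem_univ _)
      rw [sub_neg_eq_add, Real.norm_of_nonneg (by positivity)] at hl
      have hs2 : s ^ 2 ≤ 1 := by nlinarith
      calc _ ≤ (p * (s + s)) * (1 + 1) := by gcongr
        _ = 4 * p * s := by ring
        _ ≤ _ := by nlinarith [mul_nonneg hq0 hs.le, mul_nonneg hr0 hs.le]
    · have key : ∀ y : ℝ, y ^ 2 = s ^ 2 → ‖f y‖ * (1 + s ^ 2) ≤ q + r := by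
        intro y hy
        have a1 := le_seminorm_D 0 0 f y
        have a2 := le_seminorm_D 2 0 f y
        simp only [pow_zero, one_mul, sq_abs, one_apply_eq_self, hy] at a1 a2
        linarith
      have k1 := key s rfl
      have k2 := key (-s) (by ring)
      calc _ ≤ (‖f s‖ + ‖f (-s)‖) * (1 + s ^ 2) := by gcongr; exact norm_sub_le _ _
        _ ≤ 4 * (p + q + r) := by linarith
        _ ≤ _ := le_mul_of_one_le_right (by positivity) h1
  rw [hilb, norm_mul]
  have hpi : ‖(1 / (Real.pi : ℂ))‖ = 1 / Real.pi := by simp [abs_of_pos Real.pi_pos]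
  rw [hpi, ← integral_const_mul]
  have := Real.pi_pos
  gcongr
  refine norm_integral_le_of_norm_le (integrable_decay _) ?_
  filter_upwards [ae_restrict_mem measurableSet_Ioi] with s hs using hb s hs

theorem hilb_sub (f g : 𝓢(ℝ, ℂ)) (t : ℝ) : hilb (f - g : 𝓢(ℝ, ℂ)) t = hilb f t - hilb g t := by
  have := hilb_add (f - g) g t
  rw [sub_add_cancel] at this
  rw [this, add_sub_cancel_right]

/-- The seminorm bound settles `t = 0`, and translation covariance carries it to every `t`.
Pointwise continuity is all that a closed graph requires; continuity of `ℍ` into `𝓢` is never used.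
-/
theorem continuous_hilb (t : ℝ) : Continuous fun f : 𝓢(ℝ, ℂ) => hilb f t := by
  have h0 : Continuous fun f : 𝓢(ℝ, ℂ) => hilb f 0 := by
    rw [continuous_iff_continuousAt]
    intro f
    rw [ContinuousAt, tendsto_iff_norm_sub_tendsto_zero]
    have hc : Continuous fun u : 𝓢(ℝ, ℂ) =>
        1 / Real.pi * ((4 * (SchwartzMap.seminorm ℂ 0 1 (u - f) + SchwartzMap.seminorm ℂ 0 0 (u - f)
          + SchwartzMap.seminorm ℂ 2 0 (u - f))) * ∫ s in Ioi (0 : ℝ), (1 + s ^ 2)⁻¹) := by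
      have hs : Continuous fun u : 𝓢(ℝ, ℂ) => u - f := by fun_prop
      exact continuous_const.mul ((continuous_const.mul
        ((((seminorm_continuous 0 1).comp hs).add ((seminorm_continuous 0 0).comp hs)).add
          ((seminorm_continuous 2 0).comp hs))).mul continuous_const)
    have h := hc.tendsto f
    simp only [sub_self, map_zero, add_zero, mul_zero, zero_mul] at h
    refine squeeze_zero (fun _ => norm_nonneg _) (fun u => ?_) h
    rw [← hilb_sub]
    exact norm_hilb_zero_le (u - f)
  have h1 : ∀ f : 𝓢(ℝ, ℂ), hilb f t = hilb (translate t f) 0 := by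
    intro f
    rw [hilb_translate, zero_add]
  simp only [h1]
  exact h0.comp (translate t).continuous

/-! ### Moments and point values as continuous functionals -/

theorem integrable_pow_mul (n : ℕ) (f : 𝓢(ℝ, ℂ)) : Integrable fun x : ℝ => (x : ℂ) ^ n * f x := by
  simpa only [← mulX_iter_apply] using (mulX^[n] f).integrable

theorem continuous_moment (n : ℕ) : Continuous fun f : 𝓢(ℝ, ℂ) => ∫ x : ℝ, (x : ℂ) ^ n * f x := by
  have ht : Function.HasTemperateGrowth fun x : ℝ => (x : ℂ) ^ n := by fun_prop
  have h : ∀ f : 𝓢(ℝ, ℂ), ∫ x : ℝ, (x : ℂ) ^ n * f x =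
      SchwartzMap.integralCLM ℂ volume (SchwartzMap.smulLeftCLM ℂ (fun x : ℝ => (x : ℂ) ^ n) f) := by
    intro f
    rw [SchwartzMap.integralCLM_apply]
    refine integral_congr_ae (Eventually.of_forall fun x => ?_)
    simp only [SchwartzMap.smulLeftCLM_apply_apply ht, smul_eq_mul]
  simp only [h]
  fun_prop

theorem continuous_eval (x : ℝ) : Continuous fun f : 𝓢(ℝ, ℂ) => f x :=
  (continuous_eval_const (F := BoundedContinuousFunction ℝ ℂ) x).comp
    (SchwartzMap.toBoundedContinuousFunctionCLM ℂ ℝ ℂ).continuous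

/-- After the substitution `x ↦ x - a`, the binomial theorem makes each moment of the translate a
combination of moments of `f`. -/
theorem translate_mem_N (a : ℝ) {f : 𝓢(ℝ, ℂ)} (hf : f ∈ N) : translate a f ∈ N := by
  intro n
  have h1 : ∫ x : ℝ, (x : ℂ) ^ n * translate a f x =
      ∫ x : ℝ, ((x - a : ℝ) : ℂ) ^ n * f x := by
    rw [← integral_add_right_eq_self (fun x : ℝ => ((x - a : ℝ) : ℂ) ^ n * f x) a]
    simp
  have h2 : ∀ x : ℝ, ((x - a : ℝ) : ℂ) ^ n * f x =
      ∑ m ∈ Finset.range (n + 1), ((-a : ℂ) ^ (n - m) * (n.choose m : ℂ)) * ((x : ℂ) ^ m * f x) := by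
    intro x
    rw [Complex.ofReal_sub, sub_eq_add_neg, add_pow, Finset.sum_mul]
    exact Finset.sum_congr rfl fun m _ => by ring
  rw [h1]
  simp only [h2]
  rw [integral_finsetSum _ fun m _ => (integrable_pow_mul m f).const_mul _]
  refine Finset.sum_eq_zero fun m _ => ?_
  rw [integral_const_mul, hf m, mul_zero]

/-! ### Operators on `Ψ` -/

/-- Operators on the Schwartz space that preserve `N` and the functions vanishing on `[0, ∞)` and
commute with the Hilbert transform. -/
structure Admissible (L : 𝓢(ℝ, ℂ) →L[ℂ] 𝓢(ℝ, ℂ)) : Prop where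
  mem_N : ∀ f ∈ N, L f ∈ N
  vanish : ∀ f : 𝓢(ℝ, ℂ), (∀ x, 0 ≤ x → f x = 0) → ∀ x, 0 ≤ x → L f x = 0
  hilb_comm : ∀ g : N, ∀ t, hilb (L g) t = L (hilbertN g) t

/-- The sign of `a` matters only for `vanish`; the other two properties hold for translations in
both directions. -/
theorem admissible_translate {a : ℝ} (ha : 0 ≤ a) : Admissible (translate a) where
  mem_N f hf := translate_mem_N a hf
  vanish f hf x hx := by
    rw [translate_apply]
    exact hf _ (add_nonneg hx ha)
  hilb_comm g t := by
    rw [hilb_translate, translate_apply, hilbertN_apply]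

theorem admissible_D : Admissible D where
  mem_N f hf := deriv_mem hf
  vanish f hf x hx := by
    -- Nothing is known to the left of `0`, so the derivative at `x = 0` has to be read off from the
    -- right.
    have h1 := (hasDerivAt_D f x).hasDerivWithinAt (s := Ici x)
    have h2 : HasDerivWithinAt f 0 (Ici x) x :=
      (hasDerivWithinAt_const x _ (0 : ℂ)).congr (fun y hy => hf y (hx.trans hy)) (hf x hx)
    exact (uniqueDiffOn_Ici x x self_mem_Ici).eq_deriv _ h1 h2
  hilb_comm g t := by
    have h1 := hilb_D t (g : 𝓢(ℝ, ℂ))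
    rw [← funext (hilbertN_apply g)] at h1
    exact h1.unique (hasDerivAt_D _ t)

namespace Admissible

variable {L : 𝓢(ℝ, ℂ) →L[ℂ] 𝓢(ℝ, ℂ)} (hL : Admissible L)

/-- The restriction to `N`. -/
def onN : N →ₗ[ℂ] N := (L : 𝓢(ℝ, ℂ) →ₗ[ℂ] 𝓢(ℝ, ℂ)).restrict hL.mem_N

/-- The restriction to `N₋`. -/
def onNminus : Nminus →ₗ[ℂ] Nminus := hL.onN.restrict fun g hg => hL.vanish g hg

theorem coe_onNminus (g : Nminus) : ((hL.onNminus g : N) : 𝓢(ℝ, ℂ)) = L ((g : N) : 𝓢(ℝ, ℂ)) := rfl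

theorem hilbertN_onN (g : N) : hilbertN (hL.onN g) = L (hilbertN g) := by
  ext t
  rw [hilbertN_apply]
  exact hL.hilb_comm g t

theorem Pplus_onN (g : N) : Pplus (hL.onN g) = L (Pplus g) := by
  simp only [Pplus, LinearMap.smul_apply, LinearMap.add_apply, hilbertN_onN, map_smul, map_add]
  rfl

theorem Pminus_onN (g : N) : Pminus (hL.onN g) = L (Pminus g) := by
  simp only [Pminus, LinearMap.smul_apply, LinearMap.sub_apply, hilbertN_onN, map_smul, map_sub]
  rfl

/-- The operator on `Ψ` induced by an admissible operator. -/
def onPsi : Psi →ₗ[ℂ] Psi :=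
  Psi.decomp.symm.toLinearMap ∘ₗ hL.onNminus.prodMap hL.onNminus ∘ₗ Psi.decomp.toLinearMap

theorem decomp_onPsi (f : Psi) : Psi.decomp (hL.onPsi f) =
    (hL.onNminus (Psi.decomp f).1, hL.onNminus (Psi.decomp f).2) := by
  simp [onPsi]

theorem components_onPsi (f : Psi) : Psi.components (hL.onPsi f) =
    (L (Psi.components f).1, L (Psi.components f).2.1, L (Psi.components f).2.2.1,
      L (Psi.components f).2.2.2) := by
  simp only [Psi.components, decomp_onPsi, map_smul, ← hL.Pplus_onN, ← hL.Pminus_onN]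
  rfl

end Admissible

/-! ### The topology of `Ψ`: a closed subspace of `𝓢⁴` -/

namespace Psi

theorem toSchwartz_eq (f : Psi) : toSchwartz f = (components f).1 + (components f).2.1 := by
  have h : LinearEquiv.ofInjective J J_injective (decomp f) = f :=
    (LinearEquiv.ofInjective J J_injective).apply_symm_apply f
  have h2 : toSchwartz f = J (decomp f) := by
    conv_lhs => rw [← h]
    rfl
  rw [h2]
  rfl

/-- The map `f ↦ (-iP₊g, iP₋h, iP₋g, -iP₊h)` as a linear map. -/
def componentsₗ : Psi →ₗ[ℂ] 𝓢(ℝ, ℂ) × 𝓢(ℝ, ℂ) × 𝓢(ℝ, ℂ) × 𝓢(ℝ, ℂ) where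
  toFun := components
  map_add' f g := by
    simp only [components, map_add, Prod.fst_add, Prod.snd_add, Submodule.coe_add, smul_add,
      Prod.mk_add_mk]
  map_smul' c f := by
    simp only [components, map_smul, Prod.smul_fst, Prod.smul_snd, Submodule.coe_smul,
      RingHom.id_apply, Prod.smul_mk, smul_comm c]

theorem isUniformInducing_components : IsUniformInducing components := ⟨rfl⟩

theorem isInducing_components : IsInducing components := isUniformInducing_components.isInducing

theorem continuous_iff {X : Type*} [TopologicalSpace X] {u : X → Psi} :
    Continuous u ↔ Continuous fun x => components (u x) :=
  isInducing_components.continuous_iff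

theorem Pplus_add_Pminus (g : N) : Pplus g + Pminus g = (g : 𝓢(ℝ, ℂ)) := by
  simp only [Pplus, Pminus, LinearMap.smul_apply, LinearMap.add_apply, LinearMap.sub_apply,
    Submodule.subtype_apply]
  module

/-- Since `P₊ + P₋ = I`, the components of `f` recover `g` and `h`. -/
theorem components_injective : Function.Injective components := by
  change Function.Injective componentsₗ
  rw [injective_iff_map_eq_zero]
  intro f hf
  have h : components f = 0 := hf
  rw [components, Prod.mk_eq_zero, Prod.mk_eq_zero, Prod.mk_eq_zero] at h
  simp only [smul_eq_zero, neg_eq_zero, Complex.I_ne_zero, false_or] at h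
  obtain ⟨h1, h2, h3, h4⟩ := h
  have hg : ((decomp f).1 : N) = 0 := Subtype.ext <| by
    rw [← Pplus_add_Pminus, h1, h3, add_zero]
    rfl
  have hh : ((decomp f).2 : N) = 0 := Subtype.ext <| by
    rw [← Pplus_add_Pminus, h2, h4, add_zero]
    rfl
  exact decomp.map_eq_zero_iff.1 (Prod.ext (Subtype.ext hg) (Subtype.ext hh))

/-- The graph of the Hilbert transform on `N₋`. -/
def graph : Set (𝓢(ℝ, ℂ) × 𝓢(ℝ, ℂ)) :=
  {p | (∀ n : ℕ, ∫ x : ℝ, (x : ℂ) ^ n * p.1 x = 0) ∧ (∀ x : ℝ, 0 ≤ x → p.1 x = 0) ∧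
    ∀ t : ℝ, p.2 t = hilb p.1 t}

/-- Each defining condition equates two continuous functions on `𝓢 × 𝓢`. -/
theorem isClosed_graph : IsClosed graph := by
  have h1 : IsClosed {p : 𝓢(ℝ, ℂ) × 𝓢(ℝ, ℂ) | ∀ n : ℕ, ∫ x : ℝ, (x : ℂ) ^ n * p.1 x = 0} := by
    rw [ofPred_forall]
    exact isClosed_iInter fun n =>
      isClosed_eq ((continuous_moment n).comp continuous_fst) continuous_const
  have h2 : IsClosed {p : 𝓢(ℝ, ℂ) × 𝓢(ℝ, ℂ) | ∀ x : ℝ, 0 ≤ x → p.1 x = 0} := by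
    simp only [ofPred_forall]
    exact isClosed_iInter fun x => isClosed_iInter fun _ =>
      isClosed_eq ((continuous_eval x).comp continuous_fst) continuous_const
  have h3 : IsClosed {p : 𝓢(ℝ, ℂ) × 𝓢(ℝ, ℂ) | ∀ t : ℝ, p.2 t = hilb p.1 t} := by
    simp only [ofPred_forall]
    exact isClosed_iInter fun t =>
      isClosed_eq ((continuous_eval t).comp continuous_snd) ((continuous_hilb t).comp continuous_fst)
  exact h1.inter (h2.inter h3)

theorem mem_graph_iff (p : 𝓢(ℝ, ℂ) × 𝓢(ℝ, ℂ)) :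
    p ∈ graph ↔ ∃ g : Nminus, ((g : N) : 𝓢(ℝ, ℂ)) = p.1 ∧ hilbertN g = p.2 := by
  constructor
  · rintro ⟨h1, h2, h3⟩
    refine ⟨⟨⟨p.1, h1⟩, h2⟩, rfl, ?_⟩
    ext t
    rw [hilbertN_apply]
    exact (h3 t).symm
  · rintro ⟨g, hg, hw⟩
    refine ⟨?_, ?_, ?_⟩
    · rw [← hg]
      exact (g : N).2
    · rw [← hg]
      exact g.2
    · intro t
      rw [← hg, ← hw, hilbertN_apply]

/-- With `u = (-iP₊g, iP₋h, iP₋g, -iP₊h)`, the identities `P₊ + P₋ = I` and `P₊ - P₋ = iℍ` give `g =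
i(u₁ - u₃)`, `ℍg = u₁ + u₃`, `h = i(u₄ - u₂)`, `ℍh = u₂ + u₄`. These relations invert, so membership
in the graph is the only constraint on `u`. -/
theorem range_components : range components =
    {u | (Complex.I • (u.1 - u.2.2.1), u.1 + u.2.2.1) ∈ graph ∧
      (Complex.I • (u.2.2.2 - u.2.1), u.2.1 + u.2.2.2) ∈ graph} := by
  have hI : Complex.I * Complex.I = -1 := Complex.I_mul_I
  ext u
  obtain ⟨u1, u2, u3, u4⟩ := u
  simp only [mem_ofPred_eq, mem_graph_iff]
  constructor
  · rintro ⟨f, hf⟩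
    simp only [components, Prod.mk.injEq] at hf
    obtain ⟨rfl, rfl, rfl, rfl⟩ := hf
    refine ⟨⟨(decomp f).1, ?_, ?_⟩, ⟨(decomp f).2, ?_, ?_⟩⟩
    all_goals
      ext t
      simp only [Pplus, Pminus, LinearMap.smul_apply, LinearMap.add_apply, LinearMap.sub_apply,
        Submodule.subtype_apply, add_apply, sub_apply, smul_apply, smul_eq_mul]
    · linear_combination (((decomp f).1 : N) : 𝓢(ℝ, ℂ)) t * hI
    · linear_combination hilbertN (decomp f).1 t * hI
    · linear_combination (((decomp f).2 : N) : 𝓢(ℝ, ℂ)) t * hI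
    · linear_combination hilbertN (decomp f).2 t * hI
  · rintro ⟨⟨g, hg1, hg2⟩, ⟨h, hh1, hh2⟩⟩
    refine ⟨decomp.symm (g, h), ?_⟩
    simp only [components, LinearEquiv.apply_symm_apply, Pplus, Pminus, LinearMap.smul_apply,
      LinearMap.add_apply, LinearMap.sub_apply, Submodule.subtype_apply, hg1, hg2, hh1, hh2,
      Prod.mk.injEq]
    refine ⟨?_, ?_, ?_, ?_⟩
    all_goals
      ext t
      simp only [add_apply, sub_apply, smul_apply, smul_eq_mul]
    · linear_combination -u1 t * hI
    · linear_combination -u2 t * hI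
    · linear_combination -u3 t * hI
    · linear_combination -u4 t * hI

theorem isClosed_range_components : IsClosed (range components) := by
  rw [range_components]
  have h1 : Continuous fun u : 𝓢(ℝ, ℂ) × 𝓢(ℝ, ℂ) × 𝓢(ℝ, ℂ) × 𝓢(ℝ, ℂ) =>
      (Complex.I • (u.1 - u.2.2.1), u.1 + u.2.2.1) := by fun_prop
  have h2 : Continuous fun u : 𝓢(ℝ, ℂ) × 𝓢(ℝ, ℂ) × 𝓢(ℝ, ℂ) × 𝓢(ℝ, ℂ) =>
      (Complex.I • (u.2.2.2 - u.2.1), u.2.1 + u.2.2.2) := by fun_prop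
  exact (isClosed_graph.preimage h1).inter (isClosed_graph.preimage h2)

instance completeSpace : CompleteSpace Psi :=
  isUniformInducing_components.completeSpace isClosed_range_components.isComplete

instance t2Space : T2Space Psi :=
  IsEmbedding.t2Space ⟨isInducing_components, components_injective⟩

instance isUniformAddGroup : IsUniformAddGroup Psi := by
  refine ⟨isUniformInducing_components.uniformContinuous_iff.2 ?_⟩
  have h : components ∘ (fun p : Psi × Psi => p.1 - p.2) =
      fun p : Psi × Psi => components p.1 - components p.2 :=
    funext fun p => map_sub componentsₗ p.1 p.2
  rw [h]
  have hc := isUniformInducing_components.uniformContinuous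
  exact (hc.comp uniformContinuous_fst).sub (hc.comp uniformContinuous_snd)

instance continuousSMul : ContinuousSMul ℂ Psi := by
  refine ⟨continuous_iff.2 ?_⟩
  have h : ∀ p : ℂ × Psi, components (p.1 • p.2) = p.1 • components p.2 :=
    fun p => map_smul componentsₗ p.1 p.2
  simp only [h]
  exact continuous_fst.smul (isInducing_components.continuous.comp continuous_snd)

end Psi

theorem Admissible.continuous_onPsi {L : 𝓢(ℝ, ℂ) →L[ℂ] 𝓢(ℝ, ℂ)} (hL : Admissible L) :
    Continuous hL.onPsi := by
  rw [Psi.continuous_iff]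
  simp only [hL.components_onPsi]
  have h : Continuous fun u : 𝓢(ℝ, ℂ) × 𝓢(ℝ, ℂ) × 𝓢(ℝ, ℂ) × 𝓢(ℝ, ℂ) =>
      (L u.1, L u.2.1, L u.2.2.1, L u.2.2.2) := by fun_prop
  exact h.comp Psi.isInducing_components.continuous

/-! ### A nonzero element of `N₋` -/

/-- The function `P(log |x|) exp(-log² |x| + z log |x|)` on `(-∞, 0)`, extended by zero. -/
def logGauss (P : Polynomial ℂ) (z : ℂ) (x : ℝ) : ℂ :=
  if x < 0 then P.eval (Real.log x : ℂ) * Complex.exp (-(Real.log x : ℂ) ^ 2 + z * Real.log x)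
  else 0

theorem logGauss_of_neg (P : Polynomial ℂ) (z : ℂ) {x : ℝ} (hx : x < 0) : logGauss P z x =
    P.eval (Real.log x : ℂ) * Complex.exp (-(Real.log x : ℂ) ^ 2 + z * Real.log x) := if_pos hx

theorem logGauss_of_nonneg (P : Polynomial ℂ) (z : ℂ) {x : ℝ} (hx : 0 ≤ x) :
    logGauss P z x = 0 := if_neg (not_lt.2 hx)

theorem exp_log_of_neg {x : ℝ} (hx : x < 0) : Complex.exp (Real.log x) = -(x : ℂ) := by
  rw [← Complex.ofReal_exp, Real.exp_log_eq_abs hx.ne, abs_of_neg hx, Complex.ofReal_neg]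

/-- On the negative axis `e^{log|x|} = -x`. Shifting `z` therefore absorbs powers of `x`, positive
or negative, and keeps the family stable under polynomial weights and differentiation. -/
theorem logGauss_add_one (P : Polynomial ℂ) (z : ℂ) (x : ℝ) :
    logGauss P (z + 1) x = -(x : ℂ) * logGauss P z x := by
  rcases lt_or_ge x 0 with hx | hx
  · rw [logGauss_of_neg _ _ hx, logGauss_of_neg _ _ hx, ← exp_log_of_neg hx, mul_left_comm,
      ← Complex.exp_add]
    congr 2
    ring
  · rw [logGauss_of_nonneg _ _ hx, logGauss_of_nonneg _ _ hx, mul_zero]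

theorem logGauss_add_nat (P : Polynomial ℂ) (z : ℂ) (k : ℕ) (x : ℝ) :
    logGauss P (z + k) x = (-(x : ℂ)) ^ k * logGauss P z x := by
  induction k with
  | zero => simp
  | succ k ih =>
    rw [Nat.cast_add, Nat.cast_one, ← add_assoc, logGauss_add_one, ih]
    ring

theorem exists_polynomial_bound (P : Polynomial ℂ) :
    ∃ C : ℝ, 0 ≤ C ∧ ∀ u : ℝ, ‖P.eval (u : ℂ)‖ ≤ C * Real.exp |u| := by
  induction P using Polynomial.induction_on' with
  | add p q hp hq =>
    obtain ⟨C, hC, h1⟩ := hp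
    obtain ⟨B, hB, h2⟩ := hq
    refine ⟨C + B, by positivity, fun u => ?_⟩
    rw [Polynomial.eval_add, add_mul]
    exact (norm_add_le _ _).trans (add_le_add (h1 u) (h2 u))
  | monomial n a =>
    refine ⟨‖a‖ * n.factorial, by positivity, fun u => ?_⟩
    rw [Polynomial.eval_monomial, norm_mul, norm_pow, Complex.norm_real, Real.norm_eq_abs, mul_assoc]
    gcongr
    have := Real.pow_div_factorial_le_exp |u| (abs_nonneg u) n
    rwa [div_le_iff₀ (by positivity), mul_comm] at this

theorem exists_logGauss_bound (P : Polynomial ℂ) (z : ℂ) :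
    ∃ C : ℝ, 0 ≤ C ∧ ∀ x, ‖logGauss P z x‖ ≤ C := by
  obtain ⟨C, hC, h⟩ := exists_polynomial_bound P
  -- With `u = log|x|` and `m = |Re z| + 1`, the total exponent is at most `m|u| - u²`, hence at
  -- most `m²`.
  refine ⟨C * Real.exp ((|z.re| + 1) ^ 2), by positivity, fun x => ?_⟩
  rcases lt_or_ge x 0 with hx | hx
  · rw [logGauss_of_neg _ _ hx, norm_mul, Complex.norm_exp]
    set u := Real.log x
    have e : (-(u : ℂ) ^ 2 + z * u).re = -u ^ 2 + z.re * u := by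
      simp [← Complex.ofReal_pow]
    rw [e]
    calc _ ≤ (C * Real.exp |u|) * Real.exp (-u ^ 2 + z.re * u) := by gcongr; exact h u
      _ = C * Real.exp (|u| + (-u ^ 2 + z.re * u)) := by rw [mul_assoc, ← Real.exp_add]
      _ ≤ _ := by
        gcongr
        have h1 : z.re * u ≤ |z.re| * |u| := by rw [← abs_mul]; exact le_abs_self _
        have h2 : u ^ 2 = |u| ^ 2 := (sq_abs u).symm
        nlinarith [sq_nonneg (|u| - (|z.re| + 1)), sq_nonneg (|u|), sq_nonneg (|z.re| + 1)]
  · rw [logGauss_of_nonneg _ _ hx, norm_zero]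
    positivity

/-- The polynomial factor of the derivative of `logGauss P z`. -/
def logGaussDeriv (P : Polynomial ℂ) (z : ℂ) : Polynomial ℂ :=
  -(Polynomial.derivative P + (Polynomial.C z - 2 * Polynomial.X) * P)

/-- For `x < 0` the chain rule produces `1/x = -e^{-log|x|}`, which lowers `z` by one and explains
the sign in `logGaussDeriv`. The delicate point is `x = 0`. -/
theorem hasDerivAt_logGauss (P : Polynomial ℂ) (z : ℂ) (x : ℝ) :
    HasDerivAt (logGauss P z) (logGauss (logGaussDeriv P z) (z - 1) x) x := by
  rcases lt_trichotomy x 0 with hx | rfl | hx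
  · have hl : HasDerivAt (fun x : ℝ => (Real.log x : ℂ)) ((x : ℂ)⁻¹) x := by
      simpa using (Real.hasDerivAt_log hx.ne).ofReal_comp
    have h1 := (P.hasDerivAt (Real.log x : ℂ)).comp x hl
    have h2 := (((hl.pow 2).neg).add (hl.const_mul z)).cexp
    have h3 : HasDerivAt (logGauss P z) _ x := (h1.mul h2).congr_of_eventuallyEq <| by
      filter_upwards [Iio_mem_nhds hx] with y hy
      exact logGauss_of_neg P z hy
    refine h3.congr_deriv ?_
    have hx0 : (x : ℂ) ≠ 0 := by exact_mod_cast hx.ne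
    have hz := logGauss_add_one (logGaussDeriv P z) (z - 1) x
    rw [sub_add_cancel] at hz
    rw [← mul_right_inj' (neg_ne_zero.2 hx0), ← hz, logGauss_of_neg _ _ hx]
    simp only [logGaussDeriv, Polynomial.eval_neg, Polynomial.eval_add, Polynomial.eval_mul,
      Polynomial.eval_sub, Polynomial.eval_C, Polynomial.eval_X, Polynomial.eval_ofNat,
      Function.comp_apply, Pi.add_apply, Pi.neg_apply, Pi.pow_apply]
    field_simp
    push_cast
    ring
  · rw [logGauss_of_nonneg _ _ le_rfl]
    -- Lowering `z` by 2 writes the function as `x²` times a bounded one, so it is `o(x)` at the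
    -- origin.
    obtain ⟨C, hC, h⟩ := exists_logGauss_bound P (z - (2 : ℕ))
    rw [hasDerivAt_iff_isLittleO_nhds_zero]
    have hO : (fun h : ℝ => logGauss P z (0 + h) - logGauss P z 0 - h • (0 : ℂ)) =O[𝓝 0]
        fun h : ℝ => h ^ 2 := by
      refine Asymptotics.IsBigO.of_bound C (Eventually.of_forall fun y => ?_)
      have hz := logGauss_add_nat P (z - (2 : ℕ)) 2 y
      rw [sub_add_cancel] at hz
      rw [logGauss_of_nonneg _ _ le_rfl, zero_add, sub_zero, smul_zero, sub_zero, hz, norm_mul,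
        norm_pow, norm_neg, Complex.norm_real, norm_pow, mul_comm]
      gcongr
      exact h y
    exact hO.trans_isLittleO (Asymptotics.isLittleO_pow_id one_lt_two)
  · rw [logGauss_of_nonneg _ _ hx.le]
    refine (hasDerivAt_const x (0 : ℂ)).congr_of_eventuallyEq ?_
    filter_upwards [Ioi_mem_nhds hx] with y hy
    exact logGauss_of_nonneg P z (le_of_lt hy)

theorem exists_iteratedDeriv_logGauss (P : Polynomial ℂ) (z : ℂ) (n : ℕ) :
    ∃ Q w, iteratedDeriv n (logGauss P z) = logGauss Q w := by
  induction n with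
  | zero => exact ⟨P, z, by simp⟩
  | succ n ih =>
    obtain ⟨Q, w, h⟩ := ih
    refine ⟨logGaussDeriv Q w, w - 1, ?_⟩
    rw [iteratedDeriv_succ, h]
    exact funext fun x => (hasDerivAt_logGauss Q w x).deriv

/-- `logGauss` as a Schwartz function. -/
def logGaussSchwartz (P : Polynomial ℂ) (z : ℂ) : 𝓢(ℝ, ℂ) where
  toFun := logGauss P z
  smooth' := contDiff_of_differentiable_iteratedDeriv fun n _ => by
    obtain ⟨Q, w, h⟩ := exists_iteratedDeriv_logGauss P z n
    rw [h]
    exact fun x => (hasDerivAt_logGauss Q w x).differentiableAt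
  decay' k n := by
    obtain ⟨Q, w, h⟩ := exists_iteratedDeriv_logGauss P z n
    -- The weight `|x|^k` is absorbed by raising `w` by `k`.
    obtain ⟨C, -, hC⟩ := exists_logGauss_bound Q (w + k)
    refine ⟨C, fun x => ?_⟩
    rw [norm_iteratedFDeriv_eq_norm_iteratedDeriv, h]
    have := hC x
    rwa [logGauss_add_nat, norm_mul, norm_pow, norm_neg, Complex.norm_real] at this

theorem logGaussSchwartz_apply (P : Polynomial ℂ) (z : ℂ) (x : ℝ) :
    logGaussSchwartz P z x = logGauss P z x := rfl

/-- The substitution `x = -e^u` turns the integral into the Gaussian integral of `exp(-u² + (z +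
1)u)`. -/
theorem integral_logGauss (z : ℂ) : ∫ x : ℝ, logGauss 1 z x =
    (Real.pi : ℂ) ^ (1 / 2 : ℂ) * Complex.exp ((z + 1) ^ 2 / 4) := by
  have himg : (fun u : ℝ => -Real.exp u) '' univ = Iio 0 := by
    ext x
    simp only [image_univ, mem_range, mem_Iio]
    constructor
    · rintro ⟨u, rfl⟩
      exact neg_lt_zero.2 (Real.exp_pos u)
    · intro hx
      exact ⟨Real.log (-x), by rw [Real.exp_log (neg_pos.2 hx), neg_neg]⟩
  have hinj : InjOn (fun u : ℝ => -Real.exp u) univ :=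
    fun a _ b _ h => Real.exp_injective (neg_injective h)
  have h1 : ∫ x : ℝ, logGauss 1 z x = ∫ x in Iio (0 : ℝ), logGauss 1 z x := by
    refine (setIntegral_eq_integral_of_forall_compl_eq_zero fun x hx => ?_).symm
    exact logGauss_of_nonneg _ _ (not_lt.1 hx)
  rw [h1, ← himg, integral_image_eq_integral_abs_deriv_smul (f := fun u : ℝ => -Real.exp u)
    (f' := fun u : ℝ => -Real.exp u) MeasurableSet.univ
    (fun u _ => (Real.hasDerivAt_exp u).neg.hasDerivWithinAt) hinj, setIntegral_univ]
  have h2 : ∀ u : ℝ, |-Real.exp u| • logGauss 1 z (-Real.exp u) =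
      Complex.exp (-1 * (u : ℂ) ^ 2 + (z + 1) * u + 0) := by
    intro u
    rw [logGauss_of_neg _ _ (neg_lt_zero.2 (Real.exp_pos u)), abs_neg, abs_of_pos (Real.exp_pos u),
      Real.log_neg_eq_log, Real.log_exp, Polynomial.eval_one, one_mul, Complex.real_smul,
      Complex.ofReal_exp, ← Complex.exp_add]
    congr 1
    ring
  simp only [h2]
  rw [integral_cexp_quadratic (by simp)]
  congr 2
  · simp
  · ring

/-- A Schwartz function supported in `(-∞, 0]` all of whose moments vanish. -/
def flat : 𝓢(ℝ, ℂ) := logGaussSchwartz 1 (2 * Real.pi * Complex.I) -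
  logGaussSchwartz 1 (-(2 * Real.pi * Complex.I))

/-- The `n`-th moment is a multiple of the difference of `exp((n + 1 ± 2πi)²/4)`. The two exponents
differ by `2πi(n + 1)`, so the exponentials agree; this dictates the frequency `2π`. -/
theorem flat_mem_N : flat ∈ N := by
  intro n
  have h : ∀ z (x : ℝ), (x : ℂ) ^ n * logGauss 1 z x = (-1) ^ n * logGauss 1 (z + n) x := by
    intro z x
    rw [logGauss_add_nat, ← mul_assoc, ← mul_pow]
    congr 2
    ring
  have hi : ∀ z, Integrable fun x => (-1 : ℂ) ^ n * logGauss 1 z x :=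
    fun z => (logGaussSchwartz 1 z).integrable.const_mul _
  simp only [flat, sub_apply, logGaussSchwartz_apply, mul_sub, h]
  rw [integral_sub (hi _) (hi _), integral_const_mul, integral_const_mul, integral_logGauss,
    integral_logGauss, sub_eq_zero]
  congr 2
  rw [Complex.exp_eq_exp_iff_exists_int]
  refine ⟨n + 1, ?_⟩
  push_cast
  ring

theorem flat_of_nonneg {x : ℝ} (hx : 0 ≤ x) : flat x = 0 := by
  rw [flat, sub_apply, logGaussSchwartz_apply, logGaussSchwartz_apply,
    logGauss_of_nonneg _ _ hx, logGauss_of_nonneg _ _ hx, sub_zero]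

/-- At `log|x| = 1/4` the two oscillating factors are `e^{±iπ/2} = ±i`. -/
theorem flat_ne_zero : flat (-Real.exp (1 / 4)) ≠ 0 := by
  have hx : -Real.exp (1 / 4) < 0 := neg_lt_zero.2 (Real.exp_pos _)
  rw [flat, sub_apply, logGaussSchwartz_apply, logGaussSchwartz_apply, logGauss_of_neg _ _ hx,
    logGauss_of_neg _ _ hx, Real.log_neg_eq_log, Real.log_exp, sub_ne_zero, Polynomial.eval_one,
    one_mul, one_mul, Complex.exp_add, Complex.exp_add]
  refine fun h => absurd (mul_left_cancel₀ (Complex.exp_ne_zero _) h) ?_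
  have e1 : 2 * (Real.pi : ℂ) * Complex.I * ((1 / 4 : ℝ) : ℂ) = Real.pi / 2 * Complex.I := by
    push_cast; ring
  have e2 : -(2 * (Real.pi : ℂ) * Complex.I) * ((1 / 4 : ℝ) : ℂ) = -(Real.pi / 2 * Complex.I) := by
    push_cast; ring
  rw [e1, e2, Complex.exp_neg, Complex.exp_pi_div_two_mul_I, Complex.inv_I]
  intro h
  have := congrArg Complex.im h
  norm_num at this

/-! ### The representation on `Ψ` -/

/-- The extension `F(x) = f(x⁺) - f(x⁻)` is additive and continuous on `ℝ`, hence real-linear. -/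
theorem nnreal_additive_eq_mul {f : NNReal → ℝ} (hf : Continuous f)
    (hadd : ∀ s t, f (s + t) = f s + f t) (t : NNReal) : f t = f 1 * t := by
  -- The value `f a - f b` depends only on `a - b`, which makes `F` additive.
  have key : ∀ a b c d : NNReal, (a : ℝ) - b = c - d → f a - f b = f c - f d := by
    intro a b c d h
    have h1 : a + d = c + b := by
      apply NNReal.eq
      push_cast
      linarith
    have h2 := congrArg f h1
    rw [hadd, hadd] at h2
    linarith
  let F : ℝ →+ ℝ := AddMonoidHom.mk' (fun x => f x.toNNReal - f (-x).toNNReal) fun x y => by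
    have := key (x + y).toNNReal (-(x + y)).toNNReal (x.toNNReal + y.toNNReal)
      ((-x).toNNReal + (-y).toNNReal) (by
        push_cast
        simp only [Real.coe_toNNReal']
        rw [max_zero_sub_max_neg_zero_eq_self (x + y)]
        linarith [max_zero_sub_max_neg_zero_eq_self x, max_zero_sub_max_neg_zero_eq_self y])
    rw [this, hadd, hadd]
    ring
  have hF : Continuous F := (hf.comp continuous_real_toNNReal).sub
    (hf.comp (continuous_real_toNNReal.comp continuous_neg))
  have h0 : f 0 = 0 := by simpa using hadd 0 0
  have hFf : ∀ s : NNReal, F s = f s := fun s => by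
    change f (s : ℝ).toNNReal - f (-(s : ℝ)).toNNReal = f s
    rw [Real.toNNReal_coe, Real.toNNReal_of_nonpos (neg_nonpos.2 s.coe_nonneg), h0, sub_zero]
  have h1 := map_real_smul F hF (t : ℝ) 1
  rw [smul_eq_mul, mul_one, smul_eq_mul, hFf, ← NNReal.coe_one, hFf, mul_comm] at h1
  exact h1

namespace WH

theorem continuous_coords : Continuous fun ξ : WH => (ξ.ξ₁, ξ.ξ₂, ξ.ξ₃) := continuous_induced_dom

theorem continuous_ξ₁ : Continuous WH.ξ₁ := continuous_fst.comp continuous_coords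

theorem continuous_ξ₃ : Continuous WH.ξ₃ :=
  continuous_snd.comp (continuous_snd.comp continuous_coords)

end WH

/-- The character `e^{iξ₃}`. -/
def phase (ξ : WH) : ℂ := Complex.exp (Complex.I * ξ.ξ₃)

/-- The restriction of `U` to `S₁(0)` and `Ψ`. -/
def T (ξ : S10) : Psi →ₗ[ℂ] Psi := phase ξ • (admissible_translate ξ.2.1).onPsi

theorem components_T (ξ : S10) (f : Psi) : Psi.components (T ξ f) =
    phase ξ • (translate (ξ : WH).ξ₁ (Psi.components f).1,
      translate (ξ : WH).ξ₁ (Psi.components f).2.1, translate (ξ : WH).ξ₁ (Psi.components f).2.2.1,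
      translate (ξ : WH).ξ₁ (Psi.components f).2.2.2) := by
  rw [← (admissible_translate ξ.2.1).components_onPsi]
  exact map_smul Psi.componentsₗ _ _

theorem toSchwartz_T (ξ : S10) (f : Psi) :
    ⇑(Psi.toSchwartz (T ξ f)) = U (ξ : WH) ⇑(Psi.toSchwartz f) := by
  funext x
  have hU : U (ξ : WH) ⇑(Psi.toSchwartz f) x = Complex.exp (Complex.I * (ξ : WH).ξ₃) *
      Complex.exp (Complex.I * x * (ξ : WH).ξ₂) * Psi.toSchwartz f (x + (ξ : WH).ξ₁) := rfl
  have h2 : (ξ : WH).ξ₂ = 0 := ξ.2.2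
  rw [hU, h2, Psi.toSchwartz_eq, Psi.toSchwartz_eq, components_T]
  simp [phase]
  ring

theorem toSchwartz_injective : Function.Injective Psi.toSchwartz :=
  Subtype.val_injective

theorem T_mul (a b : S10) (f : Psi) : T (a * b) f = T a (T b f) := by
  refine toSchwartz_injective (DFunLike.coe_injective ?_)
  rw [toSchwartz_T, toSchwartz_T, toSchwartz_T, Submonoid.coe_mul, map_mul, Module.End.mul_apply]

theorem T_one (f : Psi) : T 1 f = f := by
  refine toSchwartz_injective (DFunLike.coe_injective ?_)
  rw [toSchwartz_T, Submonoid.coe_one, map_one, Module.End.one_apply]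

theorem continuous_T : Continuous fun p : S10 × Psi => T p.1 p.2 := by
  rw [Psi.continuous_iff]
  simp only [components_T]
  have h1 : Continuous fun p : S10 × Psi => (p.1 : WH).ξ₁ :=
    WH.continuous_ξ₁.comp (continuous_subtype_val.comp continuous_fst)
  have h3 : Continuous fun p : S10 × Psi => (p.1 : WH).ξ₃ :=
    WH.continuous_ξ₃.comp (continuous_subtype_val.comp continuous_fst)
  have hp : Continuous fun p : S10 × Psi => phase p.1 := by
    unfold phase
    fun_prop
  have hc : Continuous fun p : S10 × Psi => Psi.components p.2 :=
    Psi.isInducing_components.continuous.comp continuous_snd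
  have ht : ∀ {u : S10 × Psi → 𝓢(ℝ, ℂ)}, Continuous u →
      Continuous fun p => translate (p.1 : WH).ξ₁ (u p) :=
    fun hu => continuous_translate.comp (h1.prodMk hu)
  exact hp.smul ((ht hc.fst).prodMk ((ht hc.snd.fst).prodMk
    ((ht hc.snd.snd.fst).prodMk (ht hc.snd.snd.snd))))

/-! ### Differentiability along one-parameter subsemigroups -/

theorem tendsto_phase_translate_slope (α β : ℝ) (f : 𝓢(ℝ, ℂ)) :
    Tendsto (fun t : ℝ => (t : ℂ)⁻¹ •
        (Complex.exp (Complex.I * ((β * t : ℝ) : ℂ)) • translate (α * t) f - f)) (𝓝[>] 0)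
      (𝓝 ((Complex.I * β) • f + (α : ℂ) • D f)) := by
  have he : HasDerivAt (fun t : ℝ => Complex.exp (Complex.I * ((β * t : ℝ) : ℂ)))
      (Complex.I * β) 0 := by
    have h1 : HasDerivAt (fun t : ℝ => Complex.I * ((β * t : ℝ) : ℂ)) (Complex.I * β) 0 := by
      have := ((hasDerivAt_id (0 : ℝ)).const_mul β).ofReal_comp.const_mul Complex.I
      simpa using this
    simpa using h1.cexp
  have h1 : Tendsto (fun t : ℝ => (t : ℂ)⁻¹ * (Complex.exp (Complex.I * ((β * t : ℝ) : ℂ)) - 1))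
      (𝓝[>] 0) (𝓝 (Complex.I * β)) := by
    have := he.tendsto_slope_zero_right
    simpa [Complex.real_smul] using this
  have h2 : Tendsto (fun t : ℝ => Complex.exp (Complex.I * ((β * t : ℝ) : ℂ))) (𝓝[>] 0) (𝓝 1) := by
    simpa using he.continuousAt.tendsto.mono_left (nhdsWithin_le_nhds (s := Ioi 0))
  -- Product rule: `e·τf - f = (e - 1)f + e(τf - f)`, with `e` the phase and `τ` the translation.
  have h3 := (h1.smul_const f).add (h2.smul (tendsto_translate_slope f α))
  rw [one_smul] at h3
  refine h3.congr fun t => ?_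
  module

/-- The derivative of `T` along the one-parameter semigroup `t ↦ (αt, 0, βt)`. -/
def generator (α β : ℝ) : Psi →L[ℂ] Psi where
  toLinearMap := (Complex.I * β) • LinearMap.id + (α : ℂ) • admissible_D.onPsi
  cont := by
    have := admissible_D.continuous_onPsi
    exact (continuous_id.const_smul (Complex.I * (β : ℂ))).add (this.const_smul (α : ℂ))

theorem components_generator (α β : ℝ) (f : Psi) : Psi.components (generator α β f) =
    (Complex.I * β) • Psi.components f + (α : ℂ) • (D (Psi.components f).1,
      D (Psi.components f).2.1, D (Psi.components f).2.2.1, D (Psi.components f).2.2.2) := by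
  rw [← admissible_D.components_onPsi]
  change Psi.componentsₗ ((Complex.I * β) • f + (α : ℂ) • admissible_D.onPsi f) = _
  rw [map_add, map_smul, map_smul]
  rfl

/-- Since `ξ₂ = 0` on `S₁(0)`, the twist in the multiplication disappears and `ξ₁`, `ξ₃` are
additive along `γ`, hence linear in `t`. The limit is then taken in each of the four components. -/
theorem T_differentiable (γ : NNReal → S10) (hγ : Continuous γ)
    (hmul : ∀ s t, γ (s + t) = γ s * γ t) : ∃ A : Psi →L[ℂ] Psi, ∀ φ : Psi,
      Tendsto (fun t : NNReal => (((t : ℝ) : ℂ))⁻¹ • (T (γ t) φ - φ)) (𝓝[>] 0) (𝓝 (A φ)) := by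
  have hγ' : Continuous fun t => (γ t : WH) := continuous_subtype_val.comp hγ
  have h1 := nnreal_additive_eq_mul (f := fun t => (γ t : WH).ξ₁) (WH.continuous_ξ₁.comp hγ')
    fun s t => by simp [hmul]
  have h3 := nnreal_additive_eq_mul (f := fun t => (γ t : WH).ξ₃) (WH.continuous_ξ₃.comp hγ')
    fun s t => by
      have : (γ t : WH).ξ₂ = 0 := (γ t).2.2
      simp [hmul, this]
  set α := (γ 1 : WH).ξ₁
  set β := (γ 1 : WH).ξ₃
  refine ⟨generator α β, fun φ => ?_⟩
  rw [Psi.isInducing_components.tendsto_nhds_iff, components_generator]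
  have hcoe : Tendsto (fun t : NNReal => (t : ℝ)) (𝓝[>] 0) (𝓝[>] 0) := by
    refine tendsto_nhdsWithin_iff.2 ⟨?_, ?_⟩
    · exact (NNReal.continuous_coe.tendsto 0).mono_left nhdsWithin_le_nhds
    · filter_upwards [self_mem_nhdsWithin] with t ht
      exact NNReal.coe_pos.2 ht
  have hs : ∀ f, Tendsto (fun t : NNReal => (((t : ℝ) : ℂ))⁻¹ •
      (Complex.exp (Complex.I * ((β * t : ℝ) : ℂ)) • translate (α * t) f - f)) (𝓝[>] 0)
      (𝓝 ((Complex.I * β) • f + (α : ℂ) • D f)) :=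
    fun f => (tendsto_phase_translate_slope α β f).comp hcoe
  have h := (hs (Psi.components φ).1).prodMk_nhds ((hs (Psi.components φ).2.1).prodMk_nhds
    ((hs (Psi.components φ).2.2.1).prodMk_nhds (hs (Psi.components φ).2.2.2)))
  refine h.congr fun t => ?_
  have e : Psi.components ((((t : ℝ) : ℂ))⁻¹ • (T (γ t) φ - φ)) =
      (((t : ℝ) : ℂ))⁻¹ • (Psi.components (T (γ t) φ) - Psi.components φ) := by
    change Psi.componentsₗ _ = _
    rw [map_smul, map_sub]
    rfl
  rw [Function.comp_apply, e, components_T, phase, h1 t, h3 t]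
  rfl

theorem T_isDifferentiableRep : IsDifferentiableRep T where
  isUniformAddGroup := inferInstance
  continuousSMul := inferInstance
  t2Space := inferInstance
  completeSpace := inferInstance
  continuous := continuous_T
  map_mul := T_mul
  map_one := T_one
  differentiable γ hγ _ hmul := T_differentiable γ hγ hmul

/-! ### Failure of surjectivity and of extension to subgroups -/

theorem exists_T_not_surjective : ∃ ξ : S10, ¬ Function.Surjective (T ξ) := by
  -- With shift `a = e^{1/4}`, the first `N₋`-component of any `T ξ φ` takes at `-a` a multiple of
  -- the value at `0` of an element of `N₋`, which is zero. The pair `(flat, 0)` is therefore not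
  -- attained.
  refine ⟨⟨⟨Real.exp (1 / 4), 0, 0⟩, (Real.exp_pos _).le, rfl⟩, fun hsurj => ?_⟩
  obtain ⟨φ, hφ⟩ := hsurj (Psi.decomp.symm (⟨⟨flat, flat_mem_N⟩, fun _ => flat_of_nonneg⟩, 0))
  have h := congrArg Psi.decomp hφ
  rw [LinearEquiv.apply_symm_apply, T, LinearMap.smul_apply, map_smul,
    Admissible.decomp_onPsi] at h
  have h1 := congrArg (fun p : Nminus × Nminus => ((p.1 : N) : 𝓢(ℝ, ℂ)) (-Real.exp (1 / 4))) h
  simp only [Prod.smul_fst, Submodule.coe_smul, smul_apply, Admissible.coe_onNminus,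
    translate_apply, neg_add_cancel] at h1
  rw [(Psi.decomp φ).1.2 0 le_rfl, smul_zero] at h1
  exact flat_ne_zero h1.symm

/-- In a representation of `H` every operator has the inverse `T'(ξ⁻¹)`, so an extension would make
every `T ξ` surjective. This is purely algebraic and needs no continuity of `T'`. -/
theorem not_extendsTo_T (H : Subgroup WH) (hH : S10 ≤ H.toSubmonoid) : ¬ ExtendsTo T H := by
  rintro ⟨T', hT'⟩
  obtain ⟨ξ, hξ⟩ := exists_T_not_surjective
  refine hξ fun ψ => ?_
  have hmem : (ξ : WH) ∈ H := hH ξ.2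
  refine ⟨T' ⟨ξ, hmem⟩⁻¹ ψ, ?_⟩
  rw [← hT' ξ ξ.2 hmem, ← Module.End.mul_apply, ← map_mul, mul_inv_cancel, map_one,
    Module.End.one_apply]

theorem S10_le_K : S10 ≤ K.toSubmonoid := fun _ h => h.2

end

end RiggedWH

theorem proposition5 :
    ∃ T : RiggedWH.S10 → (RiggedWH.Psi →ₗ[ℂ] RiggedWH.Psi),
      -- `T ξ` is the restriction of `U ξ` to `Ψ`
      (∀ (ξ : RiggedWH.S10) (f : RiggedWH.Psi),
        ⇑(RiggedWH.Psi.toSchwartz (T ξ f)) =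
          RiggedWH.U (ξ : RiggedWH.WH) ⇑(RiggedWH.Psi.toSchwartz f)) ∧
      RiggedWH.IsDifferentiableRep T ∧
      (¬ RiggedWH.ExtendsTo T RiggedWH.K) ∧
      (∀ H : Subgroup RiggedWH.WH, RiggedWH.S10 ≤ H.toSubmonoid → ¬ RiggedWH.ExtendsTo T H) :=
  ⟨RiggedWH.T, RiggedWH.toSchwartz_T, RiggedWH.T_isDifferentiableRep,
    RiggedWH.not_extendsTo_T _ RiggedWH.S10_le_K, RiggedWH.not_extendsTo_T⟩
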